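/- A Beurling weight is a sequence $\nu=(\nu_k)_{k\in\mathbb Z}$ of reals with $\nu_j\ge 1$, $\nu_j=\nu_{-j}$ and $\nu_{j+k}\le\nu_j\nu_k$ for all $j,k\in\mathbb Z$. Put $A(\nu)=\lim_{k\to\infty}\frac{\log\nu_k}{k}=\inf_{k\ge1}\frac{\log\nu_k}{k}\ge 0$ and $\mathcal R_\nu=\{z\in\mathbb C: e^{-A(\nu)}\le|z|\le e^{A(\nu)}\}$. Let $\Gamma$ be the unit circle, let $\varphi_k$ denote the Fourier coefficients of $\varphi\in L^1(\Gamma)$, and let $W_\nu=\{\varphi\in L^1(\Gamma):\sum_{j\in\mathbb Z}\nu_j|\varphi_j|<\infty\}$. A function $\varphi\in W_\nu$ is regarded as a continuous function on $\mathcal R_\nu$ through $\varphi(z)=\sum_j\varphi_jz^j$. Let $H_+\subset L^2(\Gamma)$ be the Hardy space of functions whose negative Fourier coefficients vanish, $P_+$ the orthogonal projection onto it, and $T(\varphi)u=P_+(\varphi u)$, $u\in H_+$. For $n\ge0$ let $P_n$ be the orthogonal projection of $L^2(\Gamma)$ onto the space $\mathcal P_n$ of polynomials of degree at most $n$, and let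 $T_n(\varphi)=P_nT(\varphi)|_{\mathcal P_n}$. Matrix entries refer to the orthonormal basis $z^0,z^1,z^2,\dots$, so that $T(\varphi)_{jk}=\varphi_{j-k}$. Theorem. Let $\nu$ be a Beurling weight and let $\varphi\in W_\nu$ satisfy $\varphi(z)\ne0$ for all $z\in\mathcal R_\nu$ and $\mathrm{wind}(\varphi,0)=0$ (winding number along $\Gamma$). Then $T(\varphi)$ is invertible, and $\varphi$ has a Wiener--Hopf factorization $\varphi=\varphi_+\varphi_-$ on $\Gamma$, where $\varphi_+$ is analytic in $|z|<1$, $\varphi_-$ is analytic in $|z|>1$ with $\varphi_-(\infty)=1$, and both are continuous and non-vanishing up to $\Gamma$; moreover $\varphi_+,\varphi_-,\varphi_+^{-1},\varphi_-^{-1}\in W_\nu$. For $m\ge0$ write $$|||\varphi|||_{0,m}=\max_{\gamma\in\{\varphi_+,\varphi_-,\varphi_+^{-1},\varphi_-^{-1}\}}\ \sum_{|k|\ge m}|\gamma_k| .$$ There are a constant $c(\varphi)$ and an $N(\varphi)$, depending only on $\varphi$, such that for all $n\ge N(\varphi)$ the operator $T_n(\varphi)$ is invertible and $$\left|T_n(\varphi)^{-1}_{jk}-T(\varphi)^{-1}_{jk}\right|\le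 c(\varphi)\,\min\left\{|||\varphi|||_{0,n+1-k},\ |||\varphi|||_{0,n+1-j}\right\},\qquad 0\le j,k\le n.$$ In particular, if $A(\nu)>0$, there is a constant $c_\nu(\varphi)$ such that for all $n\ge N(\varphi)$ and $0\le j,k\le n$ $$\left|T_n(\varphi)^{-1}_{jk}-T(\varphi)^{-1}_{jk}\right|\le c_\nu(\varphi)\,\min\left\{e^{-(n+1-k)A(\nu)},\ e^{-(n+1-j)A(\nu)}\right\},$$ and if $\nu$ increases on $\mathbb Z_+$, i.e. $\nu_j\le\nu_k$ for $0\le j<k$, there is a constant $c_\nu(\varphi)$ such that for all $n\ge N(\varphi)$ and $0\le j,k\le n$ $$\left|T_n(\varphi)^{-1}_{jk}-T(\varphi)^{-1}_{jk}\right|\le c_\nu(\varphi)\,\min\left\{\nu_{n+1-k}^{-1},\ \nu_{n+1-j}^{-1}\right\}.$$ -/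

import Mathlib

open MeasureTheory Filter Topology
open scoped ENNReal Real

namespace BeurlingToeplitz

noncomputable section

/-! ### Beurling weights -/

/-- A Beurling weight: a symmetric submultiplicative weight on `ℤ`, bounded below by `1`. -/
structure IsBeurlingWeight (ν : ℤ → ℝ) : Prop where
  one_le : ∀ j, 1 ≤ ν j
  symm : ∀ j, ν j = ν (-j)
  submul : ∀ j k, ν (j + k) ≤ ν j * ν k

/-- `A(ν) = inf_{k ≥ 1} (log ν_k) / k`; for a Beurling weight it is also the limit of
`(log ν_k) / k`, see `IsBeurlingWeight.tendsto_growthRate`. -/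
def growthRate (ν : ℤ → ℝ) : ℝ :=
  sInf ((fun k : ℕ => Real.log (ν k) / k) '' Set.Ici 1)

theorem IsBeurlingWeight.tendsto_growthRate {ν : ℤ → ℝ} (h : IsBeurlingWeight ν) :
    Tendsto (fun k : ℕ => Real.log (ν k) / k) atTop (𝓝 (growthRate ν)) := by
  have hs : Subadditive (fun k : ℕ => Real.log (ν k)) := by
    intro m n
    have hpos : ∀ j, 0 < ν j := fun j => lt_of_lt_of_le one_pos (h.one_le j)
    rw [← Real.log_mul (hpos _).ne' (hpos _).ne']
    refine Real.log_le_log (hpos _) ?_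
    push_cast
    exact h.submul _ _
  have hb : BddBelow (Set.range fun k : ℕ => Real.log (ν k) / k) := by
    refine ⟨0, ?_⟩
    rintro _ ⟨k, rfl⟩
    exact div_nonneg (Real.log_nonneg (h.one_le _)) (Nat.cast_nonneg _)
  have ht := hs.tendsto_lim hb
  rw [Subadditive.lim] at ht
  exact ht

/-- The closed annulus `R_ν = {z : e^{-A(ν)} ≤ |z| ≤ e^{A(ν)}}`. -/
def annulus (ν : ℤ → ℝ) : Set ℂ :=
  {z | Real.exp (-growthRate ν) ≤ ‖z‖ ∧ ‖z‖ ≤ Real.exp (growthRate ν)}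

/-! ### The unit circle and the Beurling class -/

instance factTwoPiPos : Fact (0 < 2 * π) := ⟨Real.two_pi_pos⟩

/-- The unit circle, parametrized by `θ ↦ e^{iθ}`, `θ ∈ ℝ / 2πℤ`. Its normalized measure is
`AddCircle.haarAddCircle`; `fourier k` is the function `z ^ k`, and `fourierCoeff φ k` is the
Fourier coefficient `φ_k`. -/
abbrev Γ : Type := AddCircle (2 * π)

/-- The normalized Lebesgue measure `dθ / 2π`. -/
abbrev μΓ : Measure Γ := AddCircle.haarAddCircle

/-- The Beurling class `W_ν` (its elements are represented by functions). -/
def beurlingClass (ν : ℤ → ℝ) : Set (Γ → ℂ) :=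
  {φ | Integrable φ μΓ ∧ Summable fun j : ℤ => ν j * ‖fourierCoeff φ j‖}

/-- The Laurent series `∑ φ_j z^j`. For `φ ∈ W_ν` it converges absolutely on `R_ν`; there it is the
extension of `φ`, and on the unit circle it is the continuous representative of `φ`. -/
def laurentExt (φ : Γ → ℂ) (z : ℂ) : ℂ :=
  ∑' j : ℤ, fourierCoeff φ j * z ^ j

/-- The seminorm `‖φ‖_{ν,n} = ∑_{|k| ≥ n} ν_k |φ_k|`. -/
def tailSeminorm (ν : ℤ → ℝ) (n : ℕ) (φ : Γ → ℂ) : ℝ :=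
  ∑' k : {k : ℤ // (n : ℤ) ≤ |k|}, ν k * ‖fourierCoeff φ k‖

/-! ### Winding number and Wiener-Hopf factorization -/

/-- The restriction to the unit circle of a function on the plane, `θ ↦ f (e^{iθ})`. -/
def onCircle (f : ℂ → ℂ) : Γ → ℂ := fun θ => f (AddCircle.toCircle θ : ℂ)

/-- `wind(f, 0) = m`: along `θ ↦ f (e^{iθ})`, `0 ≤ θ ≤ 2π`, which does not meet `0`, a continuous
choice of the argument increases by `2π m`. -/
def HasWindingNumber (f : ℂ → ℂ) (m : ℤ) : Prop :=
  ∃ a : ℝ → ℝ, ContinuousOn a (Set.Icc 0 (2 * π)) ∧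
    (∀ θ ∈ Set.Icc 0 (2 * π), f (Complex.exp (θ * Complex.I)) ≠ 0 ∧
      f (Complex.exp (θ * Complex.I)) =
        ‖f (Complex.exp (θ * Complex.I))‖ * Complex.exp (a θ * Complex.I)) ∧
    a (2 * π) - a 0 = 2 * π * m

/-- `φ = φ₊ φ₋` is the Wiener-Hopf factorization of `φ`: `φ₊` is analytic in the open unit disc,
`φ₋` is analytic outside the closed unit disc with `φ₋(∞) = 1`, both are continuous up to the unit
circle and vanish nowhere, and `φ = φ₊ φ₋` on the unit circle. -/
structure IsWienerHopf (φ : Γ → ℂ) (φp φm : ℂ → ℂ) : Prop where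
  plus_analytic : DiffContOnCl ℂ φp (Metric.ball 0 1)
  plus_ne_zero : ∀ z, ‖z‖ ≤ 1 → φp z ≠ 0
  minus_analytic : DiffContOnCl ℂ φm {z | 1 < ‖z‖}
  minus_ne_zero : ∀ z, 1 ≤ ‖z‖ → φm z ≠ 0
  minus_infty : Tendsto φm (Bornology.cobounded ℂ) (𝓝 1)
  eq_mul : ∀ᵐ θ ∂μΓ, φ θ = onCircle φp θ * onCircle φm θ

/-- `|||φ|||_{ν,n}`, the largest of the seminorms `‖·‖_{ν,n}` of `φ₊`, `φ₋`, `1/φ₊`, `1/φ₋`. -/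
def tripleSeminorm (ν : ℤ → ℝ) (n : ℕ) (φp φm : ℂ → ℂ) : ℝ :=
  max (max (tailSeminorm ν n (onCircle φp)) (tailSeminorm ν n (onCircle φm)))
    (max (tailSeminorm ν n (onCircle φp⁻¹)) (tailSeminorm ν n (onCircle φm⁻¹)))

/-! ### Toeplitz operators and their truncations -/

/-- `L²` of the unit circle. -/
abbrev L2 : Type := Lp ℂ 2 μΓ

/-- The function `z ^ k` as an element of `L²`. -/
abbrev zPow (k : ℤ) : L2 := fourierLp 2 k

theorem fourierCoeff_eq_inner (u : L2) (k : ℤ) : fourierCoeff u k = inner ℂ (zPow k) u := by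
  rw [← fourierBasis_repr u k, HilbertBasis.repr_apply_apply, coe_fourierBasis]

/-- The Hardy space `H₊`: the functions in `L²` whose negative Fourier coefficients vanish. -/
def Hplus : Submodule ℂ L2 where
  carrier := {u | ∀ k : ℤ, k < 0 → fourierCoeff u k = 0}
  add_mem' := by
    intro u v hu hv k hk
    have h1 := hu k hk
    have h2 := hv k hk
    rw [fourierCoeff_eq_inner] at h1 h2 ⊢
    rw [inner_add_right, h1, h2, add_zero]
  zero_mem' := by
    intro k _
    rw [fourierCoeff_eq_inner, inner_zero_right]
  smul_mem' := by
    intro c u hu k hk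
    have h1 := hu k hk
    rw [fourierCoeff_eq_inner] at h1 ⊢
    rw [inner_smul_right, h1, mul_zero]

theorem isClosed_Hplus : IsClosed (Hplus : Set L2) := by
  have : (Hplus : Set L2) = ⋂ k : ℤ, ⋂ _ : k < 0, {u : L2 | inner ℂ (zPow k) u = 0} := by
    ext u
    simp only [Set.mem_iInter, Set.mem_ofPred_eq, ← fourierCoeff_eq_inner]
    rfl
  rw [this]
  refine isClosed_iInter fun k => isClosed_iInter fun _ => ?_
  exact isClosed_eq (by fun_prop) continuous_const

instance : CompleteSpace Hplus := isClosed_Hplus.completeSpace_coe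

/-- The space of polynomials of degree at most `n`. -/
def polys (n : ℕ) : Submodule ℂ L2 :=
  Submodule.span ℂ (Set.range fun j : Fin (n + 1) => zPow ((j : ℕ) : ℤ))

instance (n : ℕ) : FiniteDimensional ℂ (polys n) :=
  FiniteDimensional.span_of_finite ℂ (Set.finite_range _)

theorem mono_mem_Hplus (k : ℕ) : zPow (k : ℤ) ∈ Hplus := by
  intro j hj
  rw [fourierCoeff_eq_inner]
  exact (orthonormal_fourier (T := 2 * π)).2 (by omega)

theorem polys_le_Hplus (n : ℕ) : polys n ≤ Hplus := by
  refine Submodule.span_le.2 ?_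
  rintro _ ⟨j, rfl⟩
  exact mono_mem_Hplus j

/-- The class of `φ` in `L^∞` (and `0` if `φ` is not essentially bounded). -/
def toLinfty (φ : Γ → ℂ) : Lp ℂ ∞ μΓ :=
  open Classical in if h : MemLp φ ∞ μΓ then h.toLp φ else 0

/-- Multiplication by `f ∈ L^∞` on `L²`. -/
def mulL2 (f : Lp ℂ ∞ μΓ) : L2 →L[ℂ] L2 :=
  (ContinuousLinearMap.mul ℂ ℂ).holderL μΓ ∞ 2 2 f

/-- The Toeplitz operator `T(φ) u = P₊ (φ u)` on `H₊`. -/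
def toeplitz (φ : Γ → ℂ) : Hplus →L[ℂ] Hplus :=
  Hplus.orthogonalProjectionOnto ∘L mulL2 (toLinfty φ) ∘L Hplus.subtypeL

/-- The truncation `T_n(φ) = P_n T(φ)` restricted to the polynomials of degree at most `n`. -/
def truncToeplitz (n : ℕ) (φ : Γ → ℂ) : polys n →L[ℂ] polys n :=
  (polys n).orthogonalProjectionOnto ∘L Hplus.subtypeL ∘L toeplitz φ ∘L
    (polys n).subtypeL.codRestrict Hplus fun u => polys_le_Hplus n u.2

/-- The basis vector `z ^ k` of `H₊`. -/
def monoH (k : ℕ) : Hplus := ⟨zPow k, mono_mem_Hplus k⟩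

/-- The basis vector `z ^ k` of the space of polynomials of degree at most `n`. -/
def monoP (n : ℕ) (k : Fin (n + 1)) : polys n :=
  ⟨zPow ((k : ℕ) : ℤ), Submodule.subset_span ⟨k, rfl⟩⟩

/-- The matrix entry `T(φ)^{-1}_{jk}`, for `T(φ)` invertible. -/
def toeplitzInvEntry (φ : Γ → ℂ) (j k : ℕ) : ℂ :=
  inner ℂ (monoH j) (Ring.inverse (toeplitz φ) (monoH k))

/-- The matrix entry `T_n(φ)^{-1}_{jk}`, `0 ≤ j, k ≤ n`, for `T_n(φ)` invertible. -/
def truncInvEntry (n : ℕ) (φ : Γ → ℂ) (j k : Fin (n + 1)) : ℂ :=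
  inner ℂ (monoP n j) (Ring.inverse (truncToeplitz n φ) (monoP n k))

end

end BeurlingToeplitz

open BeurlingToeplitz

namespace BeurlingToeplitz

noncomputable section

/-! ### Fourier coefficients of continuous functions -/

/-! Write `φ = p m` with `p` analytic, `m` anti-analytic, and inverses `p'`, `m'` of the same kinds.
Toeplitz operators are multiplicative when the right symbol is analytic or the left one
anti-analytic. So `T(φ) = T(m) T(p)`, with inverse `B = T(p') T(m')`.

With `S = T(z^{n+1})` and `S' = S*`, block inversion shows that `T_n(φ)` is invertible as soon as
the complementary section `S' B S` is. With `G = (S' B S)⁻¹`, its inverse is the compression of `B -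
B S G S' B`. The error at `(j, k)` is thus `-⟨S' B* z^j, G S' B z^k⟩`. Since `T(m') z^k` has degree
at most `k`, only the coefficients of `p'` of index at least `n + 1 - k` survive in `S' B z^k`.
Conjugation gives the same for `S' B* z^j` and `m'`. Moreover `S' B S → T(p' m')` in norm, and this
limit is invertible, so `G` is uniformly bounded (`tendsto_complementary_section`). The error is
therefore bounded by a product of two tails (`exists_error_bound`), which is stronger than the
minimum.

The factorization comes from Banach algebra theory. Gelfand theory gives Wiener's lemma in `W_ν`.
Hence `φ` is a Laurent polynomial without zeros on the annulus times the inverse of some `1 - a`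
with `a` small. Linear factors are treated explicitly (`exists_factorable_mono_sub`), `1 - a` by a
Neumann series for a projected equation (`factorable_one_sub`), and winding number zero removes the
remaining power of `z`.

The constants must not depend on `ν`. They are taken from the factorization in the unweighted Wiener
algebra, and uniqueness (`IsWienerHopf.onCircle_eq`) identifies its factors with those found in
`W_ν`. -/

theorem integrable_continuousMap (f : C(Γ, ℂ)) : Integrable f μΓ :=
  f.continuous.integrable_of_hasCompactSupport (HasCompactSupport.of_compactSpace _)

/-- The Fourier coefficient as a continuous linear functional on `C(Γ, ℂ)`. -/
def coeffCLM (k : ℤ) : C(Γ, ℂ) →L[ℂ] ℂ :=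
  LinearMap.mkContinuous
    { toFun := fun f => fourierCoeff f k
      map_add' := fun f g => by
        rw [ContinuousMap.coe_add]
        exact congrFun (fourierCoeff.add (integrable_continuousMap f) (integrable_continuousMap g)) k
      map_smul' := fun c f => by
        rw [ContinuousMap.coe_smul]
        exact fourierCoeff.const_smul _ c k } 1 (by
      intro f
      simp only [LinearMap.coe_mk, AddHom.coe_mk, one_mul, fourierCoeff]
      refine (norm_integral_le_of_norm_le_const (C := ‖f‖) (Eventually.of_forall fun x => ?_)).trans
        (by simp)
      rw [smul_eq_mul, norm_mul]
      rw [fourier_apply, Circle.norm_coe, one_mul]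
      exact f.norm_coe_le_norm x)

theorem coeffCLM_apply (k : ℤ) (f : C(Γ, ℂ)) : coeffCLM k f = fourierCoeff f k := rfl

theorem fourierCoeff_fourier_apply (j k : ℤ) :
    fourierCoeff (fourier j : C(Γ, ℂ)) k = if k = j then 1 else 0 := by
  rw [fourierCoeff_fourier, Pi.single_apply]

theorem fourierCoeff_fourier_mul (j k : ℤ) (g : C(Γ, ℂ)) :
    fourierCoeff (fourier j * g : C(Γ, ℂ)) k = fourierCoeff g (k - j) := by
  unfold fourierCoeff
  refine integral_congr_ae (Eventually.of_forall fun t => ?_)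
  simp only [ContinuousMap.mul_apply, smul_eq_mul]
  rw [show -(k - j) = -k + j by ring, fourier_add, mul_assoc]

/-- The Fourier series of `f` converges uniformly, so it may be multiplied by `g` and then fed to
the continuous functional `coeffCLM k`. -/
theorem hasSum_fourierCoeff_mul {f : C(Γ, ℂ)} (hf : Summable (fourierCoeff f)) (g : C(Γ, ℂ))
    (k : ℤ) : HasSum (fun j => fourierCoeff f j * fourierCoeff g (k - j))
      (fourierCoeff (f * g : C(Γ, ℂ)) k) := by
  have h := ((hasSum_fourier_series_of_summable hf).mul_right g).mapL (coeffCLM k)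
  have e : (fun j => fourierCoeff f j * fourierCoeff g (k - j)) =
      fun j => coeffCLM k (fourierCoeff f j • fourier j * g) := by
    funext j
    rw [smul_mul_assoc, map_smul, coeffCLM_apply, fourierCoeff_fourier_mul, smul_eq_mul]
  rw [e]
  exact h

theorem continuousMap_ext_of_fourierCoeff {f g : C(Γ, ℂ)}
    (h : ∀ k, fourierCoeff f k = fourierCoeff g k) : f = g := by
  have h0 : fourierCoeff (f - g : C(Γ, ℂ)) = 0 := by
    funext k
    have := map_sub (coeffCLM k) f g
    simp only [coeffCLM_apply, h k, sub_self] at this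
    exact this
  have h1 := hasSum_fourier_series_of_summable (f := f - g) (by rw [h0]; exact summable_zero)
  rw [h0] at h1
  simp only [Pi.zero_apply, zero_smul] at h1
  exact sub_eq_zero.1 (h1.unique hasSum_zero)

/-- Trigonometric polynomials are dense in `C(Γ, ℂ)`, so `f` integrates to zero against every
continuous function. Indicators of closed sets are bounded pointwise limits of such functions, and
integrals over closed sets determine `f`. -/
theorem ae_eq_zero_of_fourierCoeff_eq_zero {f : Γ → ℂ} (hf : Integrable f μΓ)
    (h : ∀ k, fourierCoeff f k = 0) : f =ᵐ[μΓ] 0 := by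
  have hint : ∀ g : C(Γ, ℂ), Integrable (fun t => g t * f t) μΓ := fun g =>
    hf.bdd_mul g.continuous.aestronglyMeasurable (Eventually.of_forall g.norm_coe_le_norm)
  let S : Submodule ℂ C(Γ, ℂ) :=
    { carrier := {g | ∫ t, g t * f t ∂μΓ = 0}
      add_mem' := by
        intro a b ha hb
        simp only [Set.mem_ofPred_eq, ContinuousMap.add_apply, add_mul] at *
        rw [integral_add (hint a) (hint b), ha, hb, add_zero]
      zero_mem' := by simp
      smul_mem' := by
        intro c a ha
        simp only [Set.mem_ofPred_eq, ContinuousMap.smul_apply, smul_eq_mul, mul_assoc] at *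
        rw [integral_const_mul, ha, mul_zero] }
  have hS : IsClosed (S : Set C(Γ, ℂ)) := by
    refine isClosed_eq (f := fun g : C(Γ, ℂ) => ∫ t, g t * f t ∂μΓ) ?_ continuous_const
    refine continuous_iff_continuousAt.2 fun g => ?_
    refine tendsto_integral_filter_of_dominated_convergence (fun t => (‖g‖ + 1) * ‖f t‖)
      (Eventually.of_forall fun g => (hint g).aestronglyMeasurable) ?_ (hf.norm.const_mul _)
      (Eventually.of_forall fun t => ?_)
    · have : ∀ᶠ g' in 𝓝 g, ‖g'‖ < ‖g‖ + 1 :=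
        continuous_norm.continuousAt.eventually_lt_const (by linarith)
      filter_upwards [this] with g' hg'
      refine Eventually.of_forall fun t => ?_
      rw [norm_mul]
      gcongr
      exact (g'.norm_coe_le_norm t).trans hg'.le
    · exact ((continuous_eval_const t).mul continuous_const).continuousAt
  have hall : ∀ g : C(Γ, ℂ), ∫ t, g t * f t ∂μΓ = 0 := by
    have h1 : Submodule.span ℂ (Set.range (fourier (T := 2 * π))) ≤ S := by
      refine Submodule.span_le.2 ?_
      rintro _ ⟨k, rfl⟩
      have := h (-k)
      rw [fourierCoeff, neg_neg] at this
      exact this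
    intro g
    have h2 : g ∈ (Submodule.span ℂ (Set.range (fourier (T := 2 * π)))).topologicalClosure := by
      rw [span_fourier_closure_eq_top]; trivial
    exact Submodule.topologicalClosure_minimal _ h1 hS h2
  refine ae_eq_zero_of_forall_setIntegral_isClosed_eq_zero hf fun s hs => ?_
  have hδ : ∀ n : ℕ, (0 : ℝ) < 1 / (n + 1) := fun n => Nat.one_div_pos_of_nat
  have hlim := thickenedIndicator_tendsto_indicator_closure hδ
    tendsto_one_div_add_atTop_nhds_zero_nat s
  rw [hs.closure_eq] at hlim
  rw [← integral_indicator hs.measurableSet]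
  have hz : ∀ n : ℕ, ∫ t, ((thickenedIndicator (hδ n) s t : ℝ) : ℂ) * f t ∂μΓ = 0 := fun n =>
    hall ⟨fun t => ((thickenedIndicator (hδ n) s t : ℝ) : ℂ), by fun_prop⟩
  have ht : Tendsto (fun n : ℕ => ∫ t, ((thickenedIndicator (hδ n) s t : ℝ) : ℂ) * f t ∂μΓ) atTop
      (𝓝 (∫ t, s.indicator f t ∂μΓ)) := by
    refine tendsto_integral_of_dominated_convergence (fun t => ‖f t‖) (fun n => ?_) hf.norm
      (fun n => Eventually.of_forall fun t => ?_) (Eventually.of_forall fun t => ?_)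
    · exact (hint ⟨fun t => ((thickenedIndicator (hδ n) s t : ℝ) : ℂ), by fun_prop⟩).aestronglyMeasurable
    · rw [norm_mul]
      refine mul_le_of_le_one_left (norm_nonneg _) ?_
      simpa using thickenedIndicator_le_one (hδ n) s t
    · have h3 := (tendsto_pi_nhds.1 hlim t)
      have h4 : Tendsto (fun n : ℕ => ((thickenedIndicator (hδ n) s t : ℝ) : ℂ) * f t) atTop
          (𝓝 (((s.indicator (fun _ => (1 : NNReal)) t : NNReal) : ℝ) * f t)) :=
        ((Complex.continuous_ofReal.tendsto _).comp
          ((NNReal.continuous_coe.tendsto _).comp h3)).mul_const _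
      convert h4 using 2
      by_cases hts : t ∈ s <;> simp [hts]
  simp only [hz] at ht
  exact (tendsto_nhds_unique ht tendsto_const_nhds)

/-! ### Convolution of sequences -/

/-- The shear `(j, k) ↦ (j, k - j)` of `ℤ × ℤ`. -/
def shear : ℤ × ℤ ≃ ℤ × ℤ where
  toFun p := (p.1, p.2 - p.1)
  invFun p := (p.1, p.2 + p.1)
  left_inv p := by simp
  right_inv p := by simp

theorem tsum_shear {E : Type*} [AddCommMonoid E] [TopologicalSpace E] (F : ℤ × ℤ → E) :
    ∑' p : ℤ × ℤ, F (p.2, p.1 - p.2) = ∑' p : ℤ × ℤ, F p :=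
  ((Equiv.prodComm ℤ ℤ).tsum_eq fun p : ℤ × ℤ => F (p.1, p.2 - p.1)).trans (shear.tsum_eq F)

/-- Submultiplicativity of the weight dominates each term by a product of weighted terms; Tonelli's
theorem after a shear of `ℤ × ℤ` sums these. -/
theorem weighted_convolution {ν : ℤ → ℝ} (h0 : ∀ j, 0 ≤ ν j)
    (hsub : ∀ j k, ν (j + k) ≤ ν j * ν k) {a b c : ℤ → ℂ}
    (ha : Summable fun j => ν j * ‖a j‖) (hb : Summable fun j => ν j * ‖b j‖)
    (hc : ∀ k, HasSum (fun j => a j * b (k - j)) (c k)) :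
    (Summable fun j => ν j * ‖c j‖) ∧
      ∑' j, ν j * ‖c j‖ ≤ (∑' j, ν j * ‖a j‖) * ∑' j, ν j * ‖b j‖ := by
  have ha0 : ∀ j, 0 ≤ ν j * ‖a j‖ := fun j => mul_nonneg (h0 j) (norm_nonneg _)
  have hb0 : ∀ j, 0 ≤ ν j * ‖b j‖ := fun j => mul_nonneg (h0 j) (norm_nonneg _)
  have hab : Summable fun p : ℤ × ℤ => (ν p.1 * ‖a p.1‖) * (ν p.2 * ‖b p.2‖) :=
    ha.mul_of_nonneg hb ha0 hb0
  have hG : Summable fun p : ℤ × ℤ => (ν p.2 * ‖a p.2‖) * (ν (p.1 - p.2) * ‖b (p.1 - p.2)‖) :=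
    ((shear.summable_iff.2 hab).prod_symm)
  have hGf := hG.prod_factor
  have hGs := hG.prod
  have hle : ∀ k, ν k * ‖c k‖ ≤ ∑' j, (ν j * ‖a j‖) * (ν (k - j) * ‖b (k - j)‖) := by
    intro k
    have hterm : ∀ j, ν k * ‖a j * b (k - j)‖ ≤ (ν j * ‖a j‖) * (ν (k - j) * ‖b (k - j)‖) := by
      intro j
      have := hsub j (k - j)
      rw [add_sub_cancel] at this
      rw [norm_mul]
      calc ν k * (‖a j‖ * ‖b (k - j)‖) ≤ (ν j * ν (k - j)) * (‖a j‖ * ‖b (k - j)‖) := by gcongr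
        _ = _ := by ring
    have hs := Summable.of_nonneg_of_le (fun j => mul_nonneg (h0 k) (norm_nonneg _)) hterm (hGf k)
    refine le_trans ?_ (hs.tsum_le_tsum hterm (hGf k))
    rcases (h0 k).eq_or_lt with hk | hk
    · simp [← hk]
    · rw [tsum_mul_left]
      have hs' : Summable fun j => ‖a j * b (k - j)‖ :=
        (summable_mul_left_iff hk.ne').1 hs
      refine mul_le_mul_of_nonneg_left ?_ (h0 k)
      rw [← (hc k).tsum_eq]
      exact norm_tsum_le_tsum_norm hs'
  have hsum := Summable.of_nonneg_of_le (fun k => mul_nonneg (h0 k) (norm_nonneg _)) hle hGs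
  refine ⟨hsum, (hsum.tsum_le_tsum hle hGs).trans (le_of_eq ?_)⟩
  rw [ha.tsum_mul_tsum hb hab, ← hG.tsum_prod' hGf]
  exact tsum_shear fun p => (ν p.1 * ‖a p.1‖) * (ν p.2 * ‖b p.2‖)

/-- Multiplicativity of `w` is demanded only where the coefficients do not vanish. This admits `w j
= z ^ j` at `z = 0` when both factors are analytic. -/
theorem tsum_convolution {a b c w : ℤ → ℂ} (ha : Summable fun j => ‖a j * w j‖)
    (hb : Summable fun j => ‖b j * w j‖)
    (hw : ∀ j k, a j ≠ 0 → b k ≠ 0 → w (j + k) = w j * w k)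
    (hc : ∀ k, HasSum (fun j => a j * b (k - j)) (c k)) :
    ∑' k, c k * w k = (∑' j, a j * w j) * ∑' j, b j * w j := by
  have hab : Summable fun p : ℤ × ℤ => (a p.1 * w p.1) * (b p.2 * w p.2) :=
    summable_mul_of_summable_norm (f := fun j => a j * w j) (g := fun j => b j * w j) ha hb
  rw [tsum_mul_tsum_of_summable_norm (f := fun j => a j * w j) (g := fun j => b j * w j) ha hb]
  have hG : Summable fun p : ℤ × ℤ => (a p.2 * w p.2) * (b (p.1 - p.2) * w (p.1 - p.2)) :=
    (shear.summable_iff.2 hab).prod_symm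
  refine Eq.trans ?_ (tsum_shear fun p : ℤ × ℤ => (a p.1 * w p.1) * (b p.2 * w p.2))
  refine Eq.trans ?_ (hG.tsum_prod' hG.prod_factor).symm
  refine tsum_congr fun k => ?_
  rw [← (hc k).tsum_eq, ← tsum_mul_right]
  refine tsum_congr fun j => ?_
  by_cases h1 : a j = 0
  · simp [h1]
  by_cases h2 : b (k - j) = 0
  · simp [h2]
  have := hw j (k - j) h1 h2
  rw [add_sub_cancel] at this
  rw [this]; ring

end

end BeurlingToeplitz

namespace BeurlingToeplitz

noncomputable section

/-! ### The Beurling algebra -/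

variable {ν : ℤ → ℝ}

theorem IsBeurlingWeight.pos (h : IsBeurlingWeight ν) (j : ℤ) : 0 < ν j :=
  one_pos.trans_le (h.one_le j)

theorem IsBeurlingWeight.summable_norm (h : IsBeurlingWeight ν) {a : ℤ → ℂ}
    (ha : Summable fun j => ν j * ‖a j‖) : Summable fun j => ‖a j‖ :=
  ha.of_nonneg_of_le (fun _ => norm_nonneg _)
    fun j => le_mul_of_one_le_left (norm_nonneg _) (h.one_le j)

theorem IsBeurlingWeight.one : IsBeurlingWeight fun _ => 1 where
  one_le _ := le_rfl
  symm _ := rfl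
  submul _ _ := by norm_num

/-- The continuous functions in the Beurling class. -/
def beurlingSubalgebra (h : IsBeurlingWeight ν) : Subalgebra ℂ C(Γ, ℂ) where
  carrier := {f | Summable fun j => ν j * ‖fourierCoeff f j‖}
  mul_mem' := by
    intro f g hf hg
    exact (weighted_convolution (fun j => (h.pos j).le) h.submul hf hg
      (hasSum_fourierCoeff_mul (h.summable_norm hf).of_norm g)).1
  add_mem' := by
    intro f g hf hg
    refine (hf.add hg).of_nonneg_of_le (fun j => mul_nonneg (h.pos j).le (norm_nonneg _))
      fun j => ?_
    rw [← mul_add]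
    refine mul_le_mul_of_nonneg_left ?_ (h.pos j).le
    rw [← coeffCLM_apply, map_add]
    exact norm_add_le _ _
  algebraMap_mem' := by
    intro r
    refine summable_of_ne_finset_zero (s := {0}) fun j hj => ?_
    have e : algebraMap ℂ C(Γ, ℂ) r = r • fourier 0 := by
      ext t; simp
    rw [e, ← coeffCLM_apply, map_smul, coeffCLM_apply, fourierCoeff_fourier_apply,
      if_neg (by simpa using hj)]
    simp

/-- The Beurling algebra `W_ν`, normed by `∑ ν_j |f_j|`. -/
def BAlg (h : IsBeurlingWeight ν) : Type := beurlingSubalgebra h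

namespace BAlg

variable {h : IsBeurlingWeight ν}

instance : CommRing (BAlg h) := inferInstanceAs (CommRing (beurlingSubalgebra h))

instance : Algebra ℂ (BAlg h) := inferInstanceAs (Algebra ℂ (beurlingSubalgebra h))

/-- The inclusion of `W_ν` in the continuous functions. -/
def toC : BAlg h →ₐ[ℂ] C(Γ, ℂ) := (beurlingSubalgebra h).val

theorem toC_injective : Function.Injective (toC : BAlg h → C(Γ, ℂ)) := Subtype.val_injective

/-- The Fourier coefficients as linear functionals. -/
def coeff (k : ℤ) : BAlg h →ₗ[ℂ] ℂ := (coeffCLM k).toLinearMap ∘ₗ toC.toLinearMap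

theorem fourierCoeff_toC (f : BAlg h) (k : ℤ) : fourierCoeff (toC f) k = coeff k f := rfl

theorem summable_coeff (f : BAlg h) : Summable fun j => ν j * ‖coeff j f‖ := f.2

theorem summable_norm_coeff (f : BAlg h) : Summable fun j => ‖coeff j f‖ :=
  h.summable_norm f.summable_coeff

@[ext]
theorem ext {f g : BAlg h} (hfg : ∀ k, coeff k f = coeff k g) : f = g :=
  toC_injective (continuousMap_ext_of_fourierCoeff hfg)

theorem hasSum_coeff_mul (f g : BAlg h) (k : ℤ) :
    HasSum (fun j => coeff j f * coeff (k - j) g) (coeff k (f * g)) :=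
  hasSum_fourierCoeff_mul f.summable_norm_coeff.of_norm (toC g) k

theorem exists_coeff_eq (h : IsBeurlingWeight ν) {a : ℤ → ℂ}
    (ha : Summable fun j => ν j * ‖a j‖) : ∃ f : BAlg h, ∀ j, coeff j f = a j := by
  have hs : Summable fun j => a j • (fourier j : C(Γ, ℂ)) := by
    refine Summable.of_norm ?_
    simpa [norm_smul, fourier_norm] using h.summable_norm ha
  have hc : ∀ k, fourierCoeff (∑' j, a j • (fourier j : C(Γ, ℂ)) : C(Γ, ℂ)) k = a k := by
    intro k
    rw [← coeffCLM_apply, (coeffCLM k).map_tsum hs, tsum_eq_single k]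
    · rw [map_smul, coeffCLM_apply, fourierCoeff_fourier_apply]; simp
    · intro j hj
      rw [map_smul, coeffCLM_apply, fourierCoeff_fourier_apply, if_neg hj.symm, smul_zero]
  refine ⟨⟨∑' j, a j • (fourier j : C(Γ, ℂ)), ?_⟩, hc⟩
  change Summable _
  simpa only [hc] using ha

/-- The element of `W_ν` with the given Fourier coefficients. -/
def ofCoeff (h : IsBeurlingWeight ν) {a : ℤ → ℂ} (ha : Summable fun j => ν j * ‖a j‖) : BAlg h :=
  (exists_coeff_eq h ha).choose

@[simp]
theorem coeff_ofCoeff {a : ℤ → ℂ} (ha : Summable fun j => ν j * ‖a j‖) (k : ℤ) :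
    coeff k (ofCoeff h ha) = a k :=
  (exists_coeff_eq h ha).choose_spec k

/-- The weighted coefficient sequence, as an element of `ℓ¹`. -/
def toLp : BAlg h →ₗ[ℂ] lp (fun _ : ℤ => ℂ) 1 where
  toFun f := ⟨fun j => ν j * coeff j f, by
    refine memℓp_gen ?_
    simpa [abs_of_pos (h.pos _)] using f.summable_coeff⟩
  map_add' f g := by
    ext j
    exact (congrArg _ (map_add (coeff j) f g)).trans (mul_add _ _ _)
  map_smul' c f := by
    ext j
    simp [mul_left_comm]

theorem toLp_apply (f : BAlg h) (j : ℤ) : toLp f j = ν j * coeff j f := rfl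

/-- The norm of `W_ν` is pulled back from `ℓ¹`; surjectivity carries completeness over. -/
theorem toLp_bijective : Function.Bijective (toLp : BAlg h → lp (fun _ : ℤ => ℂ) 1) := by
  refine ⟨fun f g hfg => ext fun k => ?_, fun a => ?_⟩
  · have := congrArg (fun a : lp (fun _ : ℤ => ℂ) 1 => a k) hfg
    simp only [toLp_apply] at this
    exact mul_left_cancel₀ (by exact_mod_cast (h.pos k).ne') this
  · have ha : Summable fun j => ν j * ‖a j / ν j‖ := by
      have h1 := (memℓp_gen_iff (by simp)).1 (lp.memℓp a)
      simp only [ENNReal.toReal_one, Real.rpow_one] at h1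
      refine h1.congr fun j => ?_
      rw [norm_div, Complex.norm_real, Real.norm_of_nonneg (h.pos j).le,
        mul_div_cancel₀ _ (h.pos j).ne']
    refine ⟨ofCoeff h ha, ?_⟩
    ext j
    rw [toLp_apply, coeff_ofCoeff, mul_div_cancel₀ _ (by exact_mod_cast (h.pos j).ne')]

instance : NormedAddCommGroup (BAlg h) :=
  NormedAddCommGroup.induced (BAlg h) (lp (fun _ : ℤ => ℂ) 1) toLp toLp_bijective.1

theorem norm_def (f : BAlg h) : ‖f‖ = ∑' j, ν j * ‖coeff j f‖ := by
  change ‖toLp f‖ = _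
  rw [lp.norm_eq_tsum_rpow (by simp)]
  simp [toLp_apply, abs_of_pos (h.pos _)]

instance : NormedCommRing (BAlg h) :=
  { (inferInstance : NormedAddCommGroup (BAlg h)), (inferInstance : CommRing (BAlg h)) with
    norm_mul_le := fun f g => by
      rw [norm_def, norm_def, norm_def]
      exact (weighted_convolution (fun j => (h.pos j).le) h.submul f.summable_coeff
        g.summable_coeff (hasSum_coeff_mul f g)).2 }

instance : NormedAlgebra ℂ (BAlg h) where
  norm_smul_le c f := by
    rw [norm_def, norm_def, ← tsum_mul_left]
    refine le_of_eq (tsum_congr fun j => ?_)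
    rw [map_smul, smul_eq_mul, norm_mul]
    ring

instance : CompleteSpace (BAlg h) := by
  have hi : Isometry (toLp : BAlg h → lp (fun _ : ℤ => ℂ) 1) :=
    AddMonoidHomClass.isometry_of_norm _ fun _ => rfl
  exact (hi.isUniformInducing.completeSpace_congr toLp_bijective.2).2 inferInstance

theorem norm_coeff_le (f : BAlg h) (k : ℤ) : ν k * ‖coeff k f‖ ≤ ‖f‖ := by
  rw [norm_def]
  exact f.summable_coeff.le_tsum k fun j _ => mul_nonneg (h.pos j).le (norm_nonneg _)

theorem norm_coeff_le' (f : BAlg h) (k : ℤ) : ‖coeff k f‖ ≤ ‖f‖ :=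
  (le_mul_of_one_le_left (norm_nonneg _) (h.one_le k)).trans (f.norm_coeff_le k)

theorem continuous_coeff (k : ℤ) : Continuous (coeff k : BAlg h → ℂ) :=
  AddMonoidHomClass.continuous_of_bound (coeff k) 1 fun f => by
    simpa using f.norm_coeff_le' k

theorem norm_ofCoeff {a : ℤ → ℂ} (ha : Summable fun j => ν j * ‖a j‖) :
    ‖ofCoeff h ha‖ = ∑' j, ν j * ‖a j‖ := by
  simp [norm_def]

theorem norm_toC_apply_le (f : BAlg h) (t : Γ) : ‖toC f t‖ ≤ ‖f‖ := by
  have hs : HasSum (fun j => coeff j f • (fourier j t : ℂ)) (toC f t) :=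
    has_pointwise_sum_fourier_series_of_summable (f := toC f) f.summable_norm_coeff.of_norm t
  rw [← hs.tsum_eq, norm_def]
  have h1 : ∀ j, ‖coeff j f • (fourier j t : ℂ)‖ = ‖coeff j f‖ := fun j => by
    rw [norm_smul, fourier_apply, Circle.norm_coe, mul_one]
  refine (norm_tsum_le_tsum_norm (f.summable_norm_coeff.congr fun j => (h1 j).symm)).trans ?_
  refine (tsum_congr h1).trans_le ?_
  exact f.summable_norm_coeff.tsum_le_tsum
    (fun j => le_mul_of_one_le_left (norm_nonneg _) (h.one_le j)) f.summable_coeff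

/-- The monomial `z ^ k` in `W_ν`. -/
def mono (k : ℤ) : BAlg h := ⟨fourier k, by
  refine summable_of_ne_finset_zero (s := {k}) fun j hj => ?_
  rw [fourierCoeff_fourier_apply, if_neg (by simpa using hj)]
  simp⟩

theorem toC_mono (k : ℤ) : toC (mono k : BAlg h) = fourier k := rfl

theorem coeff_mono (j k : ℤ) : coeff j (mono k : BAlg h) = if j = k then 1 else 0 :=
  fourierCoeff_fourier_apply k j

theorem mono_zero : (mono 0 : BAlg h) = 1 :=
  toC_injective (by rw [toC_mono, map_one]; ext t; simp)

theorem mono_add (j k : ℤ) : (mono (j + k) : BAlg h) = mono j * mono k :=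
  toC_injective (by rw [map_mul]; simp only [toC_mono]; ext t; simp)

theorem coeff_mono_mul (j k : ℤ) (f : BAlg h) : coeff k (mono j * f) = coeff (k - j) f :=
  fourierCoeff_fourier_mul j k (toC f)

theorem coeff_one (k : ℤ) : coeff k (1 : BAlg h) = if k = 0 then 1 else 0 := by
  rw [← mono_zero, coeff_mono]

theorem norm_mono (k : ℤ) : ‖(mono k : BAlg h)‖ = ν k := by
  rw [norm_def, tsum_eq_single k]
  · simp [coeff_mono]
  · intro j hj
    simp [coeff_mono, hj]

theorem hasSum_coeff_smul_mono (f : BAlg h) : HasSum (fun j => coeff j f • mono j) f := by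
  have hs : Summable fun j => coeff j f • (mono j : BAlg h) := by
    refine Summable.of_norm (f.summable_coeff.congr fun j => ?_)
    rw [norm_smul, norm_mono, mul_comm]
  convert hs.hasSum
  ext k
  have := (hs.hasSum.map (coeff k) (continuous_coeff k)).tsum_eq
  rw [← this, tsum_eq_single k]
  · simp [coeff_mono]
  · intro j hj
    simp [coeff_mono, hj.symm]

/-! ### Evaluation on the annulus -/

theorem laurentExt_toC (f : BAlg h) (z : ℂ) :
    laurentExt (toC f) z = ∑' j, coeff j f * z ^ j := rfl

theorem laurentExt_mul {f g : BAlg h} {z : ℂ}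
    (hf : Summable fun j => ‖coeff j f * z ^ j‖) (hg : Summable fun j => ‖coeff j g * z ^ j‖)
    (hz : ∀ j k, coeff j f ≠ 0 → coeff k g ≠ 0 → z ^ (j + k) = z ^ j * z ^ k) :
    laurentExt (toC (f * g)) z = laurentExt (toC f) z * laurentExt (toC g) z :=
  tsum_convolution hf hg hz (hasSum_coeff_mul f g)

end BAlg

theorem growthRate_nonneg (h : IsBeurlingWeight ν) : 0 ≤ growthRate ν :=
  ge_of_tendsto' h.tendsto_growthRate fun k => div_nonneg (Real.log_nonneg (h.one_le _)) k.cast_nonneg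

theorem IsBeurlingWeight.abs (h : IsBeurlingWeight ν) (j : ℤ) : ν j = ν j.natAbs := by
  rcases Int.natAbs_eq j with hj | hj
  · exact congrArg ν hj
  · rw [hj, Int.natAbs_neg, Int.natAbs_natCast, ← h.symm]

/-- The growth rate is an infimum, so the bound holds at every index and not only asymptotically.
This is what makes Laurent series converge up to the boundary of the annulus. -/
theorem exp_natAbs_mul_growthRate_le (h : IsBeurlingWeight ν) (j : ℤ) :
    Real.exp (j.natAbs * growthRate ν) ≤ ν j := by
  rw [h.abs]
  set k := j.natAbs
  rcases Nat.eq_zero_or_pos k with hk | hk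
  · simpa [hk] using h.one_le 0
  · have h1 : growthRate ν ≤ Real.log (ν k) / k := by
      refine csInf_le ⟨0, ?_⟩ ⟨k, hk, rfl⟩
      rintro _ ⟨n, -, rfl⟩
      exact div_nonneg (Real.log_nonneg (h.one_le _)) n.cast_nonneg
    have hk' : (0 : ℝ) < k := by exact_mod_cast hk
    rw [← Real.le_log_iff_exp_le (h.pos _)]
    rw [le_div_iff₀ hk'] at h1
    linarith

theorem norm_zpow_le_of_mem_annulus (h : IsBeurlingWeight ν) {z : ℂ} (hz : z ∈ annulus ν) (j : ℤ) :
    ‖z ^ j‖ ≤ ν j := by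
  refine le_trans ?_ (exp_natAbs_mul_growthRate_le h j)
  have hz0 : 0 < ‖z‖ := (Real.exp_pos _).trans_le hz.1
  rw [norm_zpow, Real.exp_nat_mul]
  rcases Int.natAbs_eq j with hj | hj
  · rw [hj, zpow_natCast, Int.natAbs_natCast]
    exact pow_le_pow_left₀ hz0.le hz.2 _
  · rw [hj, zpow_neg, zpow_natCast, Int.natAbs_neg, Int.natAbs_natCast, ← inv_pow]
    refine pow_le_pow_left₀ (inv_nonneg.2 hz0.le) ?_ _
    rw [inv_le_comm₀ hz0 (Real.exp_pos _), ← Real.exp_neg]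
    exact hz.1

theorem ne_zero_of_mem_annulus {z : ℂ} (hz : z ∈ annulus ν) : z ≠ 0 :=
  norm_pos_iff.1 ((Real.exp_pos _).trans_le hz.1)

/-- If the powers of `‖z‖` are dominated by `C ν_k`, then `‖z‖ ≤ exp A(ν)`. -/
theorem norm_le_exp_growthRate (h : IsBeurlingWeight ν) {r C : ℝ} (hr : 0 < r)
    (hC : ∀ k : ℕ, r ^ k ≤ C * ν k) : r ≤ Real.exp (growthRate ν) := by
  have hC0 : 0 < C := by
    have := hC 0
    simp only [pow_zero] at this
    by_contra hn
    exact absurd (this.trans (mul_nonpos_of_nonpos_of_nonneg (not_lt.1 hn) (h.pos _).le)) (by norm_num)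
  rw [← Real.log_le_iff_le_exp hr]
  have ht : Tendsto (fun k : ℕ => Real.log C / k + Real.log (ν k) / k) atTop
      (𝓝 (0 + growthRate ν)) :=
    (tendsto_const_div_atTop_nhds_zero_nat _).add h.tendsto_growthRate
  rw [zero_add] at ht
  refine ge_of_tendsto ht ((eventually_gt_atTop 0).mono fun k hk => ?_)
  have hk' : (0 : ℝ) < k := by exact_mod_cast hk
  rw [← add_div, le_div_iff₀ hk', ← Real.log_mul hC0.ne' (h.pos _).ne', mul_comm,
    ← Real.log_pow]
  exact Real.log_le_log (pow_pos hr k) (hC k)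

namespace BAlg

variable {h : IsBeurlingWeight ν}

theorem summable_laurent (f : BAlg h) {z : ℂ} (hz : z ∈ annulus ν) :
    Summable fun j => ‖coeff j f * z ^ j‖ := by
  refine f.summable_coeff.of_nonneg_of_le (fun _ => norm_nonneg _) fun j => ?_
  rw [norm_mul, mul_comm]
  exact mul_le_mul_of_nonneg_right (norm_zpow_le_of_mem_annulus h hz j) (norm_nonneg _)

theorem norm_laurentExt_le (f : BAlg h) {z : ℂ} (hz : z ∈ annulus ν) :
    ‖laurentExt (toC f) z‖ ≤ ‖f‖ := by
  rw [laurentExt_toC, norm_def]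
  refine (norm_tsum_le_tsum_norm (f.summable_laurent hz)).trans
    ((f.summable_laurent hz).tsum_le_tsum (fun j => ?_) f.summable_coeff)
  rw [norm_mul, mul_comm]
  exact mul_le_mul_of_nonneg_right (norm_zpow_le_of_mem_annulus h hz j) (norm_nonneg _)

theorem laurentExt_mul_of_mem_annulus (f g : BAlg h) {z : ℂ} (hz : z ∈ annulus ν) :
    laurentExt (toC (f * g)) z = laurentExt (toC f) z * laurentExt (toC g) z :=
  laurentExt_mul (f.summable_laurent hz) (g.summable_laurent hz)
    fun j k _ _ => zpow_add₀ (ne_zero_of_mem_annulus hz) j k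

theorem laurentExt_mono (k : ℤ) (z : ℂ) : laurentExt (toC (mono k : BAlg h)) z = z ^ k := by
  rw [laurentExt_toC, tsum_eq_single k]
  · simp [coeff_mono]
  · intro j hj
    simp [coeff_mono, hj]

theorem mono_pow (j : ℤ) (k : ℕ) : (mono j : BAlg h) ^ k = mono (k * j) := by
  induction k with
  | zero => simp [mono_zero]
  | succ k ih => rw [pow_succ, ih, ← mono_add]; congr 1; push_cast; ring

/-- **Wiener's lemma** for Beurling algebras. -/
theorem isUnit_of_laurentExt_ne_zero {f : BAlg h}
    (hf : ∀ z ∈ annulus ν, laurentExt (toC f) z ≠ 0) : IsUnit f := by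
  by_contra hu
  -- Gelfand theory: a non-unit is killed by some character. The character turns out to be
  -- evaluation at a point `z` of the annulus.
  obtain ⟨χ, hχ⟩ := WeakDual.CharacterSpace.exists_apply_eq_zero hu
  let ψ : BAlg h →ₐ[ℂ] ℂ := WeakDual.CharacterSpace.toAlgHom χ
  have hψc : Continuous ψ := map_continuous χ
  -- The factor `ν 0` is the norm of `1`, which may exceed `1`; it disappears when `k`-th roots are
  -- taken.
  have hb : ∀ k : ℤ, ‖ψ (mono k)‖ ≤ ν 0 * ν k := by
    intro k
    have := AlgHom.norm_apply_le_self_mul_norm_one ψ (mono k : BAlg h)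
    rwa [← mono_zero, norm_mono, norm_mono, mul_comm] at this
  set z := ψ (mono 1) with hz
  have hz' : z * ψ (mono (-1)) = 1 := by
    rw [hz, ← map_mul, ← mono_add, add_neg_cancel, mono_zero, map_one]
  have hz0 : z ≠ 0 := left_ne_zero_of_mul_eq_one hz'
  have hzinv : ψ (mono (-1)) = z⁻¹ := eq_inv_of_mul_eq_one_right hz'
  have hpow : ∀ k : ℤ, ψ (mono k) = z ^ k := by
    intro k
    rcases Int.eq_nat_or_neg k with ⟨n, rfl | rfl⟩
    · rw [zpow_natCast, hz, ← map_pow, mono_pow, mul_one]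
    · rw [zpow_neg, zpow_natCast, ← inv_pow, ← hzinv, ← map_pow, mono_pow, mul_neg, mul_one]
  have hmem : z ∈ annulus ν := by
    have hzp : 0 < ‖z‖ := norm_pos_iff.2 hz0
    refine ⟨?_, norm_le_exp_growthRate h hzp (C := ν 0) fun k => ?_⟩
    · rw [Real.exp_neg, inv_le_comm₀ (Real.exp_pos _) hzp]
      refine norm_le_exp_growthRate h (inv_pos.2 hzp) (C := ν 0) fun k => ?_
      have := hb (-k)
      rwa [hpow, ← h.symm, zpow_neg, norm_inv, norm_zpow, zpow_natCast, ← inv_pow] at this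
    · have := hb k
      rwa [hpow, norm_zpow, zpow_natCast] at this
  refine hf z hmem ?_
  have h1 := (f.hasSum_coeff_smul_mono.map ψ hψc).tsum_eq
  rw [laurentExt_toC]
  refine Eq.trans (tsum_congr fun j => ?_) (h1.trans hχ)
  simp only [Function.comp_apply, map_smul, hpow, smul_eq_mul]

end BAlg

end

end BeurlingToeplitz

namespace BeurlingToeplitz

noncomputable section

variable {ν : ℤ → ℝ}

/-! ### Wiener-Hopf factorization in the Beurling algebra -/

/-- The submonoid of nonpositive integers. -/
def nonposInt : AddSubmonoid ℤ where
  carrier := {k | k ≤ 0}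
  add_mem' := fun {a b} (ha : a ≤ 0) (hb : b ≤ 0) => add_nonpos ha hb
  zero_mem' := le_refl (0 : ℤ)

/-- The submonoid of nonnegative integers. -/
def nonnegInt : AddSubmonoid ℤ where
  carrier := {k | 0 ≤ k}
  add_mem' := fun {a b} (ha : 0 ≤ a) (hb : 0 ≤ b) => add_nonneg ha hb
  zero_mem' := le_refl (0 : ℤ)

theorem mem_nonposInt {k : ℤ} : k ∈ nonposInt ↔ k ≤ 0 := Iff.rfl

theorem mem_nonnegInt {k : ℤ} : k ∈ nonnegInt ↔ 0 ≤ k := Iff.rfl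

namespace BAlg

variable {h : IsBeurlingWeight ν}

/-- The elements of `W_ν` whose Fourier coefficients are supported in a submonoid of `ℤ`. -/
def supported (h : IsBeurlingWeight ν) (S : AddSubmonoid ℤ) : Subalgebra ℂ (BAlg h) where
  carrier := {f | ∀ k, k ∉ S → coeff k f = 0}
  mul_mem' := by
    intro f g hf hg k hk
    rw [← (hasSum_coeff_mul f g k).tsum_eq]
    refine (tsum_congr fun j => ?_).trans tsum_zero
    by_cases hj : j ∈ S
    · rw [hg (k - j) (fun hkj => hk (by simpa using S.add_mem hj hkj)), mul_zero]
    · rw [hf j hj, zero_mul]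
  add_mem' := by
    intro f g hf hg k hk
    rw [map_add, hf k hk, hg k hk, add_zero]
  algebraMap_mem' := by
    intro r k hk
    have : k ≠ 0 := fun h0 => hk (h0 ▸ S.zero_mem)
    rw [Algebra.algebraMap_eq_smul_one, map_smul, coeff_one, if_neg this, smul_zero]

theorem mem_supported {S : AddSubmonoid ℤ} {f : BAlg h} :
    f ∈ supported h S ↔ ∀ k, k ∉ S → coeff k f = 0 := Iff.rfl

theorem isClosed_supported (S : AddSubmonoid ℤ) : IsClosed (supported h S : Set (BAlg h)) := by
  have : (supported h S : Set (BAlg h)) = ⋂ k : ℤ, ⋂ _ : k ∉ S, {f | coeff k f = 0} := by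
    ext f
    simp [mem_supported]
  rw [this]
  exact isClosed_iInter fun k => isClosed_iInter fun _ =>
    isClosed_eq (continuous_coeff k) continuous_const

/-- The partial sums of the Neumann series stay in the subalgebra, which is closed. -/
theorem exists_inverse_of_near_one {S : AddSubmonoid ℤ} {f : BAlg h} (hf : f ∈ supported h S)
    (hn : ‖1 - f‖ < 1) : ∃ g ∈ supported h S, f * g = 1 := by
  have hg : (∑' n : ℕ, (1 - f) ^ n) * f = 1 := by
    simpa using geom_series_mul_neg (1 - f) hn
  refine ⟨∑' n : ℕ, (1 - f) ^ n, ?_, by rw [mul_comm, hg]⟩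
  have hs : HasSum (fun n : ℕ => (1 - f) ^ n) (∑' n : ℕ, (1 - f) ^ n) :=
    (summable_geometric_of_norm_lt_one hn).hasSum
  exact (isClosed_supported S).mem_of_tendsto hs (Eventually.of_forall fun F =>
    sum_mem fun n _ => pow_mem (sub_mem (one_mem _) hf) n)

theorem summable_indicator (S : Set ℤ) (f : BAlg h) :
    Summable fun j => ν j * ‖S.indicator (fun j => coeff j f) j‖ := by
  refine f.summable_coeff.of_nonneg_of_le (fun j => mul_nonneg (h.pos j).le (norm_nonneg _))
    fun j => mul_le_mul_of_nonneg_left ?_ (h.pos j).le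
  exact norm_indicator_le_norm_self _ _

/-- The restriction of the Fourier coefficients to a set. -/
def restrict (S : Set ℤ) (f : BAlg h) : BAlg h := ofCoeff h (summable_indicator S f)

theorem coeff_restrict (S : Set ℤ) (f : BAlg h) (k : ℤ) :
    coeff k (restrict S f) = S.indicator (fun j => coeff j f) k := coeff_ofCoeff _ k

theorem norm_restrict (S : Set ℤ) (f : BAlg h) :
    ‖restrict S f‖ = ∑' j, ν j * ‖S.indicator (fun j => coeff j f) j‖ := norm_ofCoeff _

theorem norm_restrict_le (S : Set ℤ) (f : BAlg h) : ‖restrict S f‖ ≤ ‖f‖ := by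
  rw [norm_restrict, norm_def]
  exact (summable_indicator S f).tsum_le_tsum
    (fun j => mul_le_mul_of_nonneg_left (norm_indicator_le_norm_self _ _) (h.pos j).le)
    f.summable_coeff

/-- `restrict` as a continuous linear map. -/
def restrictL (S : Set ℤ) : BAlg h →L[ℂ] BAlg h :=
  LinearMap.mkContinuous
    { toFun := restrict S
      map_add' := fun f g => by
        ext k
        by_cases hk : k ∈ S <;> simp [coeff_restrict, hk]
      map_smul' := fun c f => by
        ext k
        by_cases hk : k ∈ S <;> simp [coeff_restrict, hk] } 1
    fun f => by simpa using norm_restrict_le S f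

/-- `f` has a factorization into units of the algebras of analytic and anti-analytic elements, and
a continuous logarithm on the unit circle. -/
structure Factorable (f : BAlg h) : Prop where
  factors : ∃ p ∈ supported h nonnegInt, ∃ p' ∈ supported h nonnegInt,
    ∃ m ∈ supported h nonposInt, ∃ m' ∈ supported h nonposInt,
      p * p' = 1 ∧ m * m' = 1 ∧ f = p * m
  log : ∃ l : C(Γ, ℂ), ∀ t, toC f t = Complex.exp (l t)

theorem Factorable.mul {f g : BAlg h} (hf : Factorable f) (hg : Factorable g) :
    Factorable (f * g) := by
  obtain ⟨⟨p, hp, p', hp', m, hm, m', hm', h1, h2, rfl⟩, l, hl⟩ := hf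
  obtain ⟨⟨q, hq, q', hq', n, hn, n', hn', h3, h4, rfl⟩, k, hk⟩ := hg
  refine ⟨⟨p * q, mul_mem hp hq, p' * q', mul_mem hp' hq', m * n, mul_mem hm hn, m' * n',
    mul_mem hm' hn', ?_, ?_, by ring⟩, l + k, fun t => ?_⟩
  · rw [mul_mul_mul_comm, h1, h3, one_mul]
  · rw [mul_mul_mul_comm, h2, h4, one_mul]
  · rw [map_mul toC, ContinuousMap.mul_apply, hl, hk, ContinuousMap.add_apply, Complex.exp_add]

theorem Factorable.exists_inverse {f : BAlg h} (hf : Factorable f) :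
    ∃ g, f * g = 1 ∧ Factorable g := by
  obtain ⟨⟨p, hp, p', hp', m, hm, m', hm', h1, h2, rfl⟩, l, hl⟩ := hf
  have h3 : p * m * (p' * m') = 1 := by rw [mul_mul_mul_comm, h1, h2, one_mul]
  refine ⟨p' * m', h3, ⟨p', hp', p, hp, m', hm', m, hm, by rw [mul_comm, h1],
    by rw [mul_comm, h2], rfl⟩, -l, fun t => ?_⟩
  have h4 : toC (p * m) t * toC (p' * m') t = 1 := by
    rw [← ContinuousMap.mul_apply, ← map_mul, h3, map_one, ContinuousMap.one_apply]
  rw [ContinuousMap.neg_apply, Complex.exp_neg, ← hl]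
  exact eq_inv_of_mul_eq_one_right h4

/-! ### Factorization of perturbations of the identity, linear factors and polynomials -/

theorem exists_log_one_sub {a : C(Γ, ℂ)} (ha : ∀ t, ‖a t‖ < 1) :
    ∃ l : C(Γ, ℂ), ∀ t, (1 - a) t = Complex.exp (l t) := by
  have hs : ∀ t, 1 - a t ∈ Complex.slitPlane := fun t => by
    simpa [sub_eq_add_neg] using Complex.mem_slitPlane_of_norm_lt_one (z := -a t) (by simpa using ha t)
  refine ⟨⟨fun t => Complex.log (1 - a t), ?_⟩, fun t => ?_⟩
  · exact continuous_iff_continuousAt.2 fun t =>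
      ContinuousAt.clog (by fun_prop) (hs t)
  · exact (Complex.exp_log (Complex.slitPlane_ne_zero (hs t))).symm

theorem factorable_algebraMap {c : ℂ} (hc : c ≠ 0) : Factorable (algebraMap ℂ (BAlg h) c) := by
  refine ⟨⟨_, Subalgebra.algebraMap_mem _ c, _, Subalgebra.algebraMap_mem _ c⁻¹, 1, one_mem _, 1,
    one_mem _, ?_, one_mul 1, (mul_one _).symm⟩, ContinuousMap.const _ (Complex.log c), fun t => ?_⟩
  · rw [← map_mul, mul_inv_cancel₀ hc, map_one]
  · rw [AlgHom.commutes, ContinuousMap.const_apply, Complex.exp_log hc]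
    rfl

/-- Let `X y` be the part of `a y` with nonnegative frequencies, and solve `y = 1 + X y`. Then `y`
is analytic, and `(1 - a) y = 1 + X y - a y` is anti-analytic because the positive frequencies of `X
y` and `a y` cancel. Both are close to `1`, hence invertible in their subalgebras, and `1 - a = y⁻¹
· ((1 - a) y)`. -/
theorem factorable_one_sub {a : BAlg h} (ha : ‖a‖ * ν 0 ≤ 1 / 4) : Factorable (1 - a) := by
  have hν : 1 ≤ ν 0 := h.one_le 0
  have ha' : ‖a‖ ≤ 1 / 4 := (le_mul_of_one_le_right (norm_nonneg a) hν).trans ha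
  let X : BAlg h →L[ℂ] BAlg h := restrictL {k | 0 ≤ k} ∘L ContinuousLinearMap.mul ℂ (BAlg h) a
  have hX : ∀ y, ‖X y‖ ≤ ‖a‖ * ‖y‖ := fun y => (norm_restrict_le _ _).trans (norm_mul_le _ _)
  have hX1 : ‖X‖ < 1 :=
    (X.opNorm_le_bound (norm_nonneg a) hX).trans_lt (ha'.trans_lt (by norm_num))
  set y : BAlg h := (↑(Units.oneSub X hX1)⁻¹ : BAlg h →L[ℂ] BAlg h) 1 with hy
  have hyX : y - X y = 1 := by
    have := congrArg (fun T : BAlg h →L[ℂ] BAlg h => T 1) (Units.oneSub X hX1).mul_inv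
    exact this
  have h1 : ‖(1 : BAlg h)‖ = ν 0 := by rw [← mono_zero, norm_mono]
  -- Since `‖1‖ = ν 0`, the equation gives `‖y‖ ≤ 4/3 ν 0`. The resulting `1/3` keeps both `y` and
  -- `(1 - a) y` within `2/3` of `1`.
  have hyn : ‖a‖ * ‖y‖ ≤ 1 / 3 := by
    have e : ‖y‖ ≤ ν 0 + ‖a‖ * ‖y‖ := by
      calc ‖y‖ = ‖1 + X y‖ := by rw [← hyX, sub_add_cancel]
        _ ≤ ‖(1 : BAlg h)‖ + ‖X y‖ := norm_add_le _ _
        _ ≤ _ := by rw [h1]; gcongr; exact hX y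
    have e2 : ‖a‖ * ‖y‖ ≤ 1 / 4 * ‖y‖ := by gcongr
    have e3 : ‖y‖ ≤ 4 / 3 * ν 0 := by linarith
    calc ‖a‖ * ‖y‖ ≤ ‖a‖ * (4 / 3 * ν 0) := by gcongr
      _ ≤ 1 / 3 := by linarith
  have hys : y ∈ supported h nonnegInt := by
    intro k hk
    have e : y = 1 + X y := by rw [← hyX, sub_add_cancel]
    have e0 : coeff k (X y) = 0 := by
      change coeff k (restrict _ _) = 0
      rw [coeff_restrict]
      exact Set.indicator_of_notMem hk _
    rw [e, map_add, e0, coeff_one, if_neg, add_zero]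
    exact fun h0 => hk (by rw [h0]; exact zero_mem _)
  have hmy : (1 - a) * y = 1 + (X y - a * y) := by
    have : y = 1 + X y := by rw [← hyX, sub_add_cancel]
    calc (1 - a) * y = y - a * y := by ring
      _ = 1 + X y - a * y := by rw [← this]
      _ = _ := by ring
  have hms : (1 - a) * y ∈ supported h nonposInt := by
    intro k hk
    have hk0 : 0 < k := not_le.1 hk
    have e0 : coeff k (X y) = coeff k (a * y) := by
      change coeff k (restrict _ _) = _
      rw [coeff_restrict]
      exact Set.indicator_of_mem (s := {k : ℤ | 0 ≤ k}) hk0.le _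
    rw [hmy, map_add, map_sub, e0, sub_self, coeff_one, if_neg hk0.ne', add_zero]
  have hX3 : ‖X y‖ ≤ 1 / 3 := (hX y).trans hyn
  have hay : ‖a * y‖ ≤ 1 / 3 := (norm_mul_le _ _).trans hyn
  obtain ⟨p, hp, hyp⟩ := exists_inverse_of_near_one hys (by
    rw [show (1 : BAlg h) - y = -X y by rw [← hyX]; ring, norm_neg]
    linarith)
  obtain ⟨m', hm', hmm⟩ := exists_inverse_of_near_one hms (by
    rw [hmy, show (1 : BAlg h) - (1 + (X y - a * y)) = a * y - X y by ring]
    exact (norm_sub_le _ _).trans_lt (by linarith))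
  refine ⟨⟨p, hp, y, hys, _, hms, m', hm', by rw [mul_comm, hyp], hmm, ?_⟩, ?_⟩
  · rw [mul_left_comm, mul_comm p, hyp, mul_one]
  · rw [map_sub, map_one]
    exact exists_log_one_sub fun t => (norm_toC_apply_le a t).trans_lt (by linarith)

/-- Evaluation at a point of the annulus. -/
def evalHom {z : ℂ} (hz : z ∈ annulus ν) : BAlg h →ₐ[ℂ] ℂ :=
  AlgHom.ofLinearMap
    { toFun := fun f => laurentExt (toC f) z
      map_add' := fun f g => by
        simp only [laurentExt_toC]
        rw [← (f.summable_laurent hz).of_norm.tsum_add (g.summable_laurent hz).of_norm]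
        exact tsum_congr fun j => by rw [map_add, add_mul]
      map_smul' := fun c f => by
        rw [laurentExt_toC, laurentExt_toC, RingHom.id_apply, smul_eq_mul, ← tsum_mul_left]
        exact tsum_congr fun j => by rw [map_smul, smul_eq_mul, mul_assoc] }
    (by
      change laurentExt (toC (1 : BAlg h)) z = 1
      rw [← mono_zero, laurentExt_mono, zpow_zero])
    (fun f g => laurentExt_mul_of_mem_annulus f g hz)

theorem evalHom_apply {z : ℂ} (hz : z ∈ annulus ν) (f : BAlg h) :
    evalHom hz f = laurentExt (toC f) z := rfl

theorem evalHom_mono {z : ℂ} (hz : z ∈ annulus ν) (k : ℤ) :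
    evalHom hz (mono k : BAlg h) = z ^ k := laurentExt_mono k z

/-- The norm `‖c‖ ν s` of `c z^s` need not be less than `1`, so the inverse `y` is taken from
Wiener's lemma. Off `S` its coefficients satisfy `y_k = c y_{k-s}`, and the index never re-enters
`S`. Iterating, with `‖c‖ < 1` and bounded coefficients, forces `y_k = 0`. -/
theorem exists_inverse_one_sub_smul_mono {S : AddSubmonoid ℤ} {s : ℤ} (hs : s = 1 ∨ s = -1)
    (hS : ∀ k, k ∉ S → k - s ∉ S) {c : ℂ} (hc : ‖c‖ < Real.exp (-growthRate ν)) :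
    ∃ y ∈ supported h S, (1 - c • mono s) * y = 1 := by
  have hu : IsUnit (1 - c • mono s : BAlg h) := by
    refine isUnit_of_laurentExt_ne_zero fun z hz h0 => ?_
    rw [← evalHom_apply hz, map_sub, map_one, map_smul, evalHom_mono, sub_eq_zero] at h0
    have h1 : ‖c • z ^ s‖ < 1 := by
      have hzp : 0 < ‖z‖ := (Real.exp_pos _).trans_le hz.1
      have h2 : ‖z ^ s‖ ≤ Real.exp (growthRate ν) := by
        rcases hs with rfl | rfl
        · simpa using hz.2
        · rw [zpow_neg_one, norm_inv, inv_le_comm₀ hzp (Real.exp_pos _), ← Real.exp_neg]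
          exact hz.1
      rw [norm_smul]
      calc ‖c‖ * ‖z ^ s‖ ≤ ‖c‖ * Real.exp (growthRate ν) := by gcongr
        _ < Real.exp (-growthRate ν) * Real.exp (growthRate ν) := by gcongr
        _ = 1 := by rw [← Real.exp_add, neg_add_cancel, Real.exp_zero]
    rw [← h0, norm_one] at h1
    exact lt_irrefl _ h1
  obtain ⟨y, hy⟩ := hu.exists_right_inv
  refine ⟨y, fun k hk => ?_, hy⟩
  have hrec : ∀ k, k ∉ S → coeff k y = c * coeff (k - s) y := by
    intro k hk
    have h0 : k ≠ 0 := fun h0 => hk (h0 ▸ S.zero_mem)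
    have := congrArg (coeff k) hy
    rw [sub_mul, one_mul, smul_mul_assoc, map_sub, map_smul, coeff_mono_mul, coeff_one, if_neg h0,
      sub_eq_zero] at this
    exact this
  have hmem : ∀ n : ℕ, k - n * s ∉ S := by
    intro n
    induction n with
    | zero => simpa using hk
    | succ n ih => convert hS _ ih using 2; push_cast; ring
  have hit : ∀ n : ℕ, coeff k y = c ^ n * coeff (k - n * s) y := by
    intro n
    induction n with
    | zero => simp
    | succ n ih =>
      rw [ih, hrec _ (hmem n), pow_succ, mul_assoc]
      congr 4; push_cast; ring
  have hc1 : ‖c‖ < 1 := hc.trans_le (Real.exp_le_one_iff.2 (neg_nonpos.2 (growthRate_nonneg h)))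
  have ht : Tendsto (fun n : ℕ => ‖c‖ ^ n * ‖y‖) atTop (𝓝 0) := by
    simpa using (tendsto_pow_atTop_nhds_zero_of_lt_one (norm_nonneg c) hc1).mul_const ‖y‖
  refine norm_le_zero_iff.1 (ge_of_tendsto' ht fun n => ?_)
  rw [hit n, norm_mul, norm_pow]
  exact mul_le_mul_of_nonneg_left (norm_coeff_le' _ _) (by positivity)

theorem exists_log_one_sub_smul_mono (h : IsBeurlingWeight ν) (s : ℤ) {c : ℂ}
    (hc : ‖c‖ < Real.exp (-growthRate ν)) :
    ∃ l : C(Γ, ℂ), ∀ t, toC (1 - c • mono s : BAlg h) t = Complex.exp (l t) := by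
  rw [map_sub, map_one]
  refine exists_log_one_sub fun t => ?_
  rw [map_smul, toC_mono, ContinuousMap.smul_apply, norm_smul, fourier_apply, Circle.norm_coe,
    mul_one]
  exact hc.trans_le (Real.exp_le_one_iff.2 (neg_nonpos.2 (growthRate_nonneg h)))

theorem one_sub_smul_mono_mem {S : AddSubmonoid ℤ} {s : ℤ} (hs : s ∈ S) (c : ℂ) :
    (1 - c • mono s : BAlg h) ∈ supported h S := by
  refine sub_mem (one_mem _) (Subalgebra.smul_mem _ (fun k hk => ?_) c)
  rw [coeff_mono, if_neg]
  rintro rfl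
  exact hk hs

theorem factorable_one_sub_smul_mono_one {c : ℂ} (hc : ‖c‖ < Real.exp (-growthRate ν)) :
    Factorable (1 - c • mono 1 : BAlg h) := by
  obtain ⟨y, hy, hy1⟩ := exists_inverse_one_sub_smul_mono (h := h) (S := nonnegInt) (Or.inl rfl)
    (fun k hk => by rw [mem_nonnegInt] at *; omega) hc
  exact ⟨⟨_, one_sub_smul_mono_mem (mem_nonnegInt.2 zero_le_one) c, y, hy, 1, one_mem _, 1,
    one_mem _, hy1, one_mul 1, (mul_one _).symm⟩, exists_log_one_sub_smul_mono h 1 hc⟩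

theorem factorable_one_sub_smul_mono_neg_one {c : ℂ} (hc : ‖c‖ < Real.exp (-growthRate ν)) :
    Factorable (1 - c • mono (-1) : BAlg h) := by
  obtain ⟨y, hy, hy1⟩ := exists_inverse_one_sub_smul_mono (h := h) (S := nonposInt) (Or.inr rfl)
    (fun k hk => by rw [mem_nonposInt] at *; omega) hc
  exact ⟨⟨1, one_mem _, 1, one_mem _, _, one_sub_smul_mono_mem (mem_nonposInt.2 (by norm_num)) c, y,
    hy, one_mul 1, hy1, (one_mul _).symm⟩, exists_log_one_sub_smul_mono h (-1) hc⟩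

/-- A root in the inner hole gives `z - r = z (1 - r z⁻¹)`; a root beyond the outer circle gives `z
- r = -r (1 - r⁻¹ z)`. -/
theorem exists_factorable_mono_sub {r : ℂ} (hr : r ∉ annulus ν) :
    ∃ (K : ℤ) (g : BAlg h), Factorable g ∧ mono 1 - algebraMap ℂ (BAlg h) r = mono K * g := by
  by_cases h1 : ‖r‖ < Real.exp (-growthRate ν)
  · refine ⟨1, _, factorable_one_sub_smul_mono_neg_one h1, ?_⟩
    rw [mul_sub, mul_one, mul_smul_comm, ← mono_add, add_neg_cancel, mono_zero,
      Algebra.algebraMap_eq_smul_one]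
  · have h2 : Real.exp (growthRate ν) < ‖r‖ := by
      by_contra h2
      exact hr ⟨not_lt.1 h1, not_lt.1 h2⟩
    have hr0 : r ≠ 0 := norm_pos_iff.1 ((Real.exp_pos _).trans h2)
    have h3 : ‖r⁻¹‖ < Real.exp (-growthRate ν) := by
      rw [norm_inv, Real.exp_neg]
      exact inv_strictAnti₀ (Real.exp_pos _) h2
    refine ⟨0, _, (factorable_algebraMap (neg_ne_zero.2 hr0)).mul
      (factorable_one_sub_smul_mono_one h3), ?_⟩
    rw [mono_zero, one_mul, Algebra.algebraMap_eq_smul_one, Algebra.algebraMap_eq_smul_one,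
      smul_mul_assoc, one_mul, smul_sub, smul_smul, neg_mul, mul_inv_cancel₀ hr0]
    simp [sub_eq_add_neg, add_comm]

theorem exists_factorable_prod (s : Multiset ℂ) (hs : ∀ r ∈ s, r ∉ annulus ν) :
    ∃ (K : ℤ) (g : BAlg h), Factorable g ∧
      (s.map fun r => mono 1 - algebraMap ℂ (BAlg h) r).prod = mono K * g := by
  induction s using Multiset.induction_on with
  | empty =>
    exact ⟨0, 1, by simpa using factorable_algebraMap (h := h) one_ne_zero, by simp [mono_zero]⟩
  | cons r s ih =>
    obtain ⟨K, g, hg, e⟩ := ih fun x hx => hs x (Multiset.mem_cons_of_mem hx)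
    obtain ⟨K', g', hg', e'⟩ := exists_factorable_mono_sub (h := h)
      (hs r (Multiset.mem_cons_self r s))
    refine ⟨K' + K, g' * g, hg'.mul hg, ?_⟩
    rw [Multiset.map_cons, Multiset.prod_cons, e, e', mono_add, mul_mul_mul_comm]

theorem exists_factorable_aeval {q : Polynomial ℂ} (hq0 : q ≠ 0)
    (hq : ∀ z ∈ annulus ν, q.eval z ≠ 0) :
    ∃ (K : ℤ) (g : BAlg h), Factorable g ∧ Polynomial.aeval (mono 1 : BAlg h) q = mono K * g := by
  obtain ⟨K, g, hg, e⟩ := exists_factorable_prod (h := h) q.roots fun r hr hra =>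
    hq r hra (Polynomial.isRoot_of_mem_roots hr)
  refine ⟨K, algebraMap ℂ _ q.leadingCoeff * g,
    (factorable_algebraMap (Polynomial.leadingCoeff_ne_zero.2 hq0)).mul hg, ?_⟩
  conv_lhs => rw [(IsAlgClosed.splits q).eq_prod_roots]
  rw [map_mul, Polynomial.aeval_C, mul_left_comm, ← e, map_multiset_prod, Multiset.map_map]
  congr 3
  funext r
  simp

theorem exists_polynomial_near (f : BAlg h) {ε : ℝ} (hε : 0 < ε) :
    ∃ (N : ℕ) (q : Polynomial ℂ),
      ‖f - mono (-N) * Polynomial.aeval (mono 1 : BAlg h) q‖ < ε := by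
  obtain ⟨F, hF⟩ := ((Metric.tendsto_nhds.1 f.hasSum_coeff_smul_mono) ε hε).exists
  -- Every frequency of the partial sum is at least `-N`, so multiplication by `z^N` makes it a
  -- polynomial.
  let N : ℕ := F.sup Int.natAbs
  refine ⟨N, ∑ j ∈ F, Polynomial.monomial (j + N).toNat (coeff j f), ?_⟩
  rw [dist_comm, dist_eq_norm] at hF
  refine lt_of_eq_of_lt (congrArg norm (congrArg (f - ·) ?_)) hF
  rw [map_sum, Finset.mul_sum]
  refine Finset.sum_congr rfl fun j hj => ?_
  have hjN : j.natAbs ≤ N := Finset.le_sup (f := Int.natAbs) hj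
  rw [Polynomial.aeval_monomial, mono_pow, ← Algebra.smul_def, mul_smul_comm, ← mono_add]
  congr 2
  omega

/-- A Laurent polynomial `p` near `f` equals `f (1 - a)` with `a = f⁻¹ (f - p)` small. On the
annulus `|a(z)| ≤ ‖a‖ < 1`, so `p` inherits the absence of zeros and splits into admissible linear
factors; `1 - a` is then divided out. -/
theorem exists_factorable {f : BAlg h} (hf : ∀ z ∈ annulus ν, laurentExt (toC f) z ≠ 0) :
    ∃ (K : ℤ) (g : BAlg h), Factorable g ∧ f = mono K * g := by
  obtain ⟨u, hu⟩ := (isUnit_of_laurentExt_ne_zero hf).exists_right_inv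
  have hν := h.pos 0
  -- This accuracy gives `‖a‖ * ν 0 ≤ 1 / 4`, as `factorable_one_sub` requires.
  obtain ⟨N, q, hq⟩ := exists_polynomial_near f (ε := 1 / (4 * ν 0 * (‖u‖ + 1))) (by positivity)
  set p := mono (-N) * Polynomial.aeval (mono 1 : BAlg h) q with hp
  set a := u * (f - p) with ha
  have hu1 : u * f = 1 := by rw [mul_comm, hu]
  have hpa : p = f * (1 - a) := by
    rw [ha, mul_sub, mul_sub, mul_sub, hu1, ← mul_assoc, ← mul_assoc, hu]; ring
  have han : ‖a‖ * ν 0 ≤ 1 / 4 := by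
    have h1 : ‖a‖ ≤ (‖u‖ + 1) * (1 / (4 * ν 0 * (‖u‖ + 1))) := by
      refine (norm_mul_le _ _).trans ?_
      gcongr
      linarith
    have h2 : (‖u‖ + 1) * (1 / (4 * ν 0 * (‖u‖ + 1))) = 1 / (4 * ν 0) := by
      have : ‖u‖ + 1 ≠ 0 := by positivity
      field_simp
    rw [h2] at h1
    calc ‖a‖ * ν 0 ≤ 1 / (4 * ν 0) * ν 0 := by gcongr
      _ = 1 / 4 := by field_simp
  have ha1 : ‖a‖ < 1 := by
    have := le_mul_of_one_le_right (norm_nonneg a) (h.one_le 0)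
    linarith
  have hqz : ∀ z ∈ annulus ν, q.eval z ≠ 0 := by
    intro z hz h0
    have e1 : evalHom hz p = 0 := by
      rw [hp, map_mul, ← Polynomial.aeval_algHom_apply, evalHom_mono, evalHom_mono, zpow_one,
        Polynomial.coe_aeval_eq_eval, h0, mul_zero]
    rw [hpa, map_mul, mul_eq_zero, map_sub, map_one] at e1
    rcases e1 with e1 | e1
    · exact hf z hz e1
    · have e2 := norm_laurentExt_le a hz
      rw [← evalHom_apply hz, ← sub_eq_zero.1 e1, norm_one] at e2
      linarith
  have h1mem : (1 : ℂ) ∈ annulus ν := by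
    have := growthRate_nonneg h
    simp [annulus, this]
  have hq0 : q ≠ 0 := fun h0 => hqz 1 h1mem (by simp [h0])
  obtain ⟨K, g, hg, e⟩ := exists_factorable_aeval (h := h) hq0 hqz
  obtain ⟨b, hb, hbf⟩ := (factorable_one_sub han).exists_inverse
  refine ⟨-N + K, g * b, hg.mul hbf, ?_⟩
  calc f = f * (1 - a) * b := by rw [mul_assoc, hb, mul_one]
    _ = mono (-N + K) * (g * b) := by rw [← hpa, hp, e, mono_add]; ring

/-! ### Winding number and normalization of the factors -/

theorem laurentExt_toCircle (f : BAlg h) (t : Γ) :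
    laurentExt (toC f) (AddCircle.toCircle t : ℂ) = toC f t := by
  have hs := has_pointwise_sum_fourier_series_of_summable (f := toC f)
    f.summable_norm_coeff.of_norm t
  refine Eq.trans (tsum_congr fun j => ?_) hs.tsum_eq
  rw [smul_eq_mul, fourier_apply, AddCircle.toCircle_zsmul, Circle.coe_zpow]

theorem toCircle_coe (θ : ℝ) : (AddCircle.toCircle (θ : Γ) : ℂ) = Complex.exp (θ * Complex.I) := by
  rw [AddCircle.toCircle_apply_mk, Circle.coe_exp, div_self Real.two_pi_pos.ne', one_mul]

/-- On the circle the function is `exp (i K θ + l)` with `l` periodic, so `K θ + Im l` is a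
continuous argument. It differs from the given one by `2π` times a continuous integer-valued
function, hence by a constant. Comparing the endpoints gives `2π K = 0`. -/
theorem eq_zero_of_hasWindingNumber {K : ℤ} {g : BAlg h} {l : C(Γ, ℂ)}
    (hl : ∀ t, toC g t = Complex.exp (l t))
    (hw : HasWindingNumber (laurentExt (toC (mono K * g))) 0) : K = 0 := by
  obtain ⟨a, hac, ha, ha0⟩ := hw
  rw [Int.cast_zero, mul_zero, sub_eq_zero] at ha0
  have hval : ∀ θ : ℝ, laurentExt (toC (mono K * g)) (Complex.exp (θ * Complex.I)) =
      Complex.exp (K * (θ * Complex.I) + l θ) := by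
    intro θ
    rw [← toCircle_coe, laurentExt_toCircle, map_mul, ContinuousMap.mul_apply, hl, toC_mono,
      fourier_apply, AddCircle.toCircle_zsmul, Circle.coe_zpow, toCircle_coe, Complex.exp_add,
      ← Complex.exp_int_mul]
  let F : ℝ → ℝ := fun θ => (K * θ + (l θ).im - a θ) / (2 * π)
  have hint : ∀ θ ∈ Set.Icc 0 (2 * π), ∃ n : ℤ, F θ = n := by
    intro θ hθ
    obtain ⟨-, h2⟩ := ha θ hθ
    rw [hval, Complex.norm_exp, Complex.ofReal_exp, ← Complex.exp_add, Complex.exp_eq_exp_iff_exists_int] at h2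
    obtain ⟨n, hn⟩ := h2
    refine ⟨n, ?_⟩
    have := congrArg Complex.im hn
    simp at this
    simp only [F]
    rw [div_eq_iff Real.two_pi_pos.ne']
    linarith
  have hFc : ContinuousOn F (Set.Icc 0 (2 * π)) := by
    refine ContinuousOn.div_const (ContinuousOn.sub (Continuous.continuousOn ?_) hac) _
    have : Continuous fun θ : ℝ => l (θ : Γ) := l.continuous.comp (AddCircle.continuous_mk' _)
    fun_prop
  have hconst : F 0 = F (2 * π) := by
    choose! n hn using hint
    have hnc : ContinuousOn n (Set.Icc 0 (2 * π)) := by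
      have h1 : ContinuousOn (fun θ => ((n θ : ℤ) : ℝ)) (Set.Icc 0 (2 * π)) :=
        hFc.congr fun θ hθ => (hn θ hθ).symm
      exact Int.isClosedEmbedding_coe_real.isInducing.continuousOn_iff.2 h1
    have h0 : (0 : ℝ) ∈ Set.Icc 0 (2 * π) := ⟨le_rfl, Real.two_pi_pos.le⟩
    have h1 : 2 * π ∈ Set.Icc 0 (2 * π) := ⟨Real.two_pi_pos.le, le_rfl⟩
    rw [hn 0 h0, hn _ h1, isPreconnected_Icc.constant hnc h0 h1]
  simp only [F] at hconst
  rw [div_left_inj' Real.two_pi_pos.ne', ha0] at hconst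
  have hl0 : l ((2 * π : ℝ) : Γ) = l ((0 : ℝ) : Γ) := by
    rw [AddCircle.coe_period]; rfl
  rw [hl0] at hconst
  have h3 : (K : ℝ) * (2 * π) = 0 := by linarith
  rcases mul_eq_zero.1 h3 with h4 | h4
  · exact_mod_cast h4
  · exact absurd h4 Real.two_pi_pos.ne'

/-- For anti-analytic elements the zeroth coefficient is the value at infinity. Multiplicativity
shows that it is nonzero for a unit, so that it can be normalized to `1`. -/
theorem coeff_zero_mul {m n : BAlg h} (hm : m ∈ supported h nonposInt)
    (hn : n ∈ supported h nonposInt) : coeff 0 (m * n) = coeff 0 m * coeff 0 n := by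
  rw [← (hasSum_coeff_mul m n 0).tsum_eq, tsum_eq_single 0, sub_zero]
  intro j hj
  rcases lt_or_gt_of_ne hj with h1 | h1
  · rw [hn (0 - j) (by rw [mem_nonposInt]; omega), mul_zero]
  · rw [hm j (by rw [mem_nonposInt]; omega), zero_mul]

/-- **Wiener-Hopf factorization** in the Beurling algebra. -/
theorem exists_wienerHopf {f : BAlg h} (hf : ∀ z ∈ annulus ν, laurentExt (toC f) z ≠ 0)
    (hw : HasWindingNumber (laurentExt (toC f)) 0) :
    ∃ p ∈ supported h nonnegInt, ∃ p' ∈ supported h nonnegInt,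
      ∃ m ∈ supported h nonposInt, ∃ m' ∈ supported h nonposInt,
        p * p' = 1 ∧ m * m' = 1 ∧ coeff 0 m = 1 ∧ f = p * m := by
  obtain ⟨K, g, hg, rfl⟩ := exists_factorable hf
  obtain ⟨⟨p, hp, p', hp', m, hm, m', hm', h1, h2, rfl⟩, l, hl⟩ := hg
  obtain rfl := eq_zero_of_hasWindingNumber hl hw
  -- The constant `φ₋(∞)` is moved from the anti-analytic factor to the analytic one.
  set c := coeff 0 m
  have hc : c ≠ 0 := by
    have h3 := coeff_zero_mul hm hm'
    rw [h2, coeff_one, if_pos rfl] at h3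
    exact left_ne_zero_of_mul_eq_one h3.symm
  refine ⟨c • p, Subalgebra.smul_mem _ hp c, c⁻¹ • p', Subalgebra.smul_mem _ hp' _,
    c⁻¹ • m, Subalgebra.smul_mem _ hm _, c • m', Subalgebra.smul_mem _ hm' _, ?_, ?_, ?_, ?_⟩
  · rw [smul_mul_smul_comm, mul_inv_cancel₀ hc, one_smul, h1]
  · rw [smul_mul_smul_comm, inv_mul_cancel₀ hc, one_smul, h2]
  · rw [map_smul, smul_eq_mul, inv_mul_cancel₀ hc]
  · rw [smul_mul_smul_comm, mul_inv_cancel₀ hc, one_smul, mono_zero, one_mul]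

end BAlg

end

end BeurlingToeplitz

namespace BeurlingToeplitz

noncomputable section

variable {ν : ℤ → ℝ}

/-! ### Laurent series of analytic and anti-analytic elements -/

namespace BAlg

variable {h : IsBeurlingWeight ν}

/-- The powers of `z` carrying a nonzero coefficient of `f` are regular and bounded by `1`. -/
def Dominated (f : BAlg h) (z : ℂ) : Prop :=
  ∀ j, coeff j f ≠ 0 → (z ≠ 0 ∨ 0 ≤ j) ∧ ‖z ^ j‖ ≤ 1

theorem Dominated.norm_term_le {f : BAlg h} {z : ℂ} (hz : f.Dominated z) (j : ℤ) :
    ‖coeff j f * z ^ j‖ ≤ ‖coeff j f‖ := by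
  by_cases hj : coeff j f = 0
  · simp [hj]
  · rw [norm_mul]
    exact mul_le_of_le_one_right (norm_nonneg _) (hz j hj).2

theorem Dominated.summable {f : BAlg h} {z : ℂ} (hz : f.Dominated z) :
    Summable fun j => ‖coeff j f * z ^ j‖ :=
  f.summable_norm_coeff.of_nonneg_of_le (fun _ => norm_nonneg _) hz.norm_term_le

theorem dominated_of_nonneg {f : BAlg h} (hf : f ∈ supported h nonnegInt) {z : ℂ}
    (hz : ‖z‖ ≤ 1) : f.Dominated z := by
  intro j hj
  have hj0 : 0 ≤ j := by
    by_contra hn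
    exact hj (hf j hn)
  refine ⟨Or.inr hj0, ?_⟩
  lift j to ℕ using hj0
  rw [zpow_natCast, norm_pow]
  exact pow_le_one₀ (norm_nonneg z) hz

theorem dominated_of_nonpos {f : BAlg h} (hf : f ∈ supported h nonposInt) {z : ℂ}
    (hz : 1 ≤ ‖z‖) : f.Dominated z := by
  intro j hj
  have hj0 : j ≤ 0 := by
    by_contra hn
    exact hj (hf j hn)
  refine ⟨Or.inl (norm_pos_iff.1 (one_pos.trans_le hz)), ?_⟩
  obtain ⟨n, rfl⟩ := Int.exists_eq_neg_ofNat hj0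
  rw [zpow_neg, zpow_natCast, norm_inv, norm_pow]
  exact inv_le_one_of_one_le₀ (one_le_pow₀ hz)

/-- Weierstrass test with the absolute coefficients as majorant; `Dominated` lets one argument serve
the closed disc and the closed exterior. -/
theorem continuousOn_laurentExt {f : BAlg h} {S : Set ℂ} (hS : ∀ z ∈ S, f.Dominated z) :
    ContinuousOn (laurentExt (toC f)) S := by
  refine continuousOn_tsum (fun j => ?_) f.summable_norm_coeff
    (fun j z hz => (hS z hz).norm_term_le j)
  by_cases hj : coeff j f = 0
  · simp [fourierCoeff_toC, hj, continuousOn_const]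
  · exact fun z hz => (continuousAt_const.mul
      (continuousAt_zpow₀ z j (hS z hz j hj).1)).continuousWithinAt

theorem differentiableOn_laurentExt {f : BAlg h} {S : Set ℂ} (hSo : IsOpen S)
    (hS : ∀ z ∈ S, f.Dominated z) : DifferentiableOn ℂ (laurentExt (toC f)) S := by
  refine DifferentiableOn.congr (f := fun z => ∑' j, coeff j f * z ^ j) ?_ fun z _ => rfl
  refine Complex.differentiableOn_tsum_of_summable_norm f.summable_norm_coeff (fun j => ?_) hSo
    (fun j z hz => (hS z hz).norm_term_le j)
  by_cases hj : coeff j f = 0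
  · simp [hj]
  · exact fun z hz => ((differentiableAt_zpow.2 (hS z hz j hj).1).const_mul _).differentiableWithinAt

theorem laurentExt_mul_of_dominated {f g : BAlg h} {z : ℂ} (hf : f.Dominated z)
    (hg : g.Dominated z) :
    laurentExt (toC (f * g)) z = laurentExt (toC f) z * laurentExt (toC g) z := by
  refine laurentExt_mul hf.summable hg.summable fun j k hj hk => ?_
  rcases (hf j hj).1 with hz | hj0
  · exact zpow_add₀ hz j k
  rcases (hg k hk).1 with hz | hk0
  · exact zpow_add₀ hz j k
  lift j to ℕ using hj0
  lift k to ℕ using hk0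
  rw [← Nat.cast_add, zpow_natCast, zpow_natCast, zpow_natCast, pow_add]

theorem laurentExt_ne_zero_of_dominated {f g : BAlg h} {z : ℂ} (hf : f.Dominated z)
    (hg : g.Dominated z) (hfg : f * g = 1) : laurentExt (toC f) z ≠ 0 := by
  refine left_ne_zero_of_mul_eq_one (b := laurentExt (toC g) z) ?_
  rw [← laurentExt_mul_of_dominated hf hg, hfg, ← mono_zero, laurentExt_mono, zpow_zero]

theorem tendsto_laurentExt_cobounded {f : BAlg h} (hf : f ∈ supported h nonposInt) :
    Tendsto (laurentExt (toC f)) (Bornology.cobounded ℂ) (𝓝 (coeff 0 f)) := by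
  have hlim : ∑' j : ℤ, (if j = 0 then coeff 0 f else 0) = coeff 0 f := tsum_ite_eq 0 _
  rw [← hlim]
  have h1 : ∀ᶠ z : ℂ in Bornology.cobounded ℂ, 1 ≤ ‖z‖ :=
    tendsto_norm_cobounded_atTop.eventually_ge_atTop 1
  refine tendsto_tsum_of_dominated_convergence f.summable_norm_coeff (fun j => ?_)
    (h1.mono fun z hz j => (dominated_of_nonpos hf hz).norm_term_le j)
  rcases lt_trichotomy j 0 with hj | rfl | hj
  · rw [if_neg hj.ne]
    obtain ⟨n, rfl⟩ := Int.exists_eq_neg_ofNat hj.le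
    have hn : n ≠ 0 := by rintro rfl; simp at hj
    have ht : Tendsto (fun z : ℂ => (z⁻¹) ^ n) (Bornology.cobounded ℂ) (𝓝 0) := by
      simpa [hn] using (tendsto_inv₀_cobounded (α := ℂ)).pow n
    have := ht.const_mul (coeff (-(n : ℤ)) f)
    rw [mul_zero] at this
    refine this.congr fun z => ?_
    rw [zpow_neg, zpow_natCast, inv_pow, fourierCoeff_toC]
  · simp [fourierCoeff_toC]
  · rw [if_neg hj.ne']
    simp [fourierCoeff_toC, hf j (not_le.2 hj)]

theorem onCircle_laurentExt (f : BAlg h) : onCircle (laurentExt (toC f)) = toC f :=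
  funext fun t => laurentExt_toCircle f t

theorem isWienerHopf_laurentExt {φ : Γ → ℂ} {p p' m m' : BAlg h} (hp : p ∈ supported h nonnegInt)
    (hp' : p' ∈ supported h nonnegInt) (hm : m ∈ supported h nonposInt)
    (hm' : m' ∈ supported h nonposInt) (hpp : p * p' = 1) (hmm : m * m' = 1) (hm1 : coeff 0 m = 1)
    (hφ : φ =ᵐ[μΓ] toC (p * m)) : IsWienerHopf φ (laurentExt (toC p)) (laurentExt (toC m)) where
  plus_analytic := by
    refine ⟨differentiableOn_laurentExt Metric.isOpen_ball fun z hz =>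
      dominated_of_nonneg hp (mem_ball_zero_iff.1 hz).le, ?_⟩
    rw [closure_ball _ one_ne_zero]
    exact continuousOn_laurentExt fun z hz => dominated_of_nonneg hp (mem_closedBall_zero_iff.1 hz)
  plus_ne_zero z hz := laurentExt_ne_zero_of_dominated (dominated_of_nonneg hp hz)
    (dominated_of_nonneg hp' hz) hpp
  minus_analytic := by
    refine ⟨differentiableOn_laurentExt (isOpen_lt continuous_const continuous_norm) fun z hz =>
      dominated_of_nonpos hm (le_of_lt hz), ?_⟩
    refine continuousOn_laurentExt fun z hz => dominated_of_nonpos hm ?_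
    exact closure_minimal (fun z hz => le_of_lt hz) (isClosed_le continuous_const continuous_norm) hz
  minus_ne_zero z hz := laurentExt_ne_zero_of_dominated (dominated_of_nonpos hm hz)
    (dominated_of_nonpos hm' hz) hmm
  minus_infty := by
    have := tendsto_laurentExt_cobounded hm
    rwa [hm1] at this
  eq_mul := by
    filter_upwards [hφ] with t ht
    rw [ht, onCircle_laurentExt, onCircle_laurentExt, map_mul, ContinuousMap.mul_apply]

end BAlg

/-! ### Fourier coefficients of boundary values of analytic functions -/

/-- This bridges Fourier coefficients and Cauchy's theorem. -/
theorem circleIntegral_zpow_mul (F : ℂ → ℂ) (k : ℤ) :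
    (∮ z in C(0, 1), z ^ (-k - 1) * F z) =
      2 * π * Complex.I * fourierCoeff (onCircle F) k := by
  rw [fourierCoeff_eq_intervalIntegral _ k 0, circleIntegral, zero_add]
  have h1 : ∀ θ : ℝ, deriv (circleMap 0 1) θ • ((circleMap 0 1 θ) ^ (-k - 1) * F (circleMap 0 1 θ)) =
      Complex.I * ((fourier (-k) (θ : Γ) : ℂ) • onCircle F θ) := by
    intro θ
    have e1 : circleMap 0 1 θ = (AddCircle.toCircle (θ : Γ) : ℂ) := by
      rw [BAlg.toCircle_coe, circleMap]; simp
    have hz : (AddCircle.toCircle (θ : Γ) : ℂ) ≠ 0 := Circle.coe_ne_zero _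
    rw [deriv_circleMap, e1, fourier_apply, AddCircle.toCircle_zsmul, Circle.coe_zpow, onCircle,
      smul_eq_mul, smul_eq_mul, zpow_sub_one₀ hz]
    field_simp
  simp only [h1]
  rw [intervalIntegral.integral_const_mul, Complex.real_smul]
  push_cast
  have : (π : ℂ) ≠ 0 := by exact_mod_cast Real.pi_ne_zero
  field_simp

/-- Differentiability at the origin is not required: `F` may be an exterior function after
inversion, of which only the limit at infinity is known. Cauchy's theorem tolerates the exceptional
point. -/
theorem fourierCoeff_onCircle_of_neg {F : ℂ → ℂ} (hc : ContinuousOn F (Metric.closedBall 0 1))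
    (hd : ∀ z ∈ Metric.ball (0 : ℂ) 1 \ {0}, DifferentiableAt ℂ F z) {k : ℤ} (hk : k < 0) :
    fourierCoeff (onCircle F) k = 0 := by
  have h1 := circleIntegral_zpow_mul F k
  obtain ⟨n, hn⟩ := Int.eq_ofNat_of_zero_le (show 0 ≤ -k - 1 by omega)
  rw [hn] at h1
  simp only [zpow_natCast] at h1
  have h3 : (∮ z in C(0, 1), z ^ n * F z) = 0 :=
    Complex.circleIntegral_eq_zero_of_differentiable_on_off_countable zero_le_one
      (Set.countable_singleton 0) ((continuous_pow n).continuousOn.mul hc)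
      (fun z hz => (differentiableAt_pow n).mul (hd z hz))
  rw [h3] at h1
  have h2 : (2 * π * Complex.I : ℂ) ≠ 0 := Complex.two_pi_I_ne_zero
  exact (mul_eq_zero.1 h1.symm).resolve_left h2

theorem fourierCoeff_onCircle_zero {F : ℂ → ℂ} (hc : ContinuousOn F (Metric.closedBall 0 1))
    (hd : ∀ z ∈ Metric.ball (0 : ℂ) 1 \ {0}, DifferentiableAt ℂ F z) :
    fourierCoeff (onCircle F) 0 = F 0 := by
  have h1 := circleIntegral_zpow_mul F 0
  have h3 := Complex.circleIntegral_sub_center_inv_smul_of_differentiable_on_off_countable one_pos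
    (Set.countable_singleton 0) hc hd
  simp only [sub_zero, smul_eq_mul] at h3
  simp only [neg_zero, zero_sub, zpow_neg_one, h3] at h1
  exact (mul_left_cancel₀ Complex.two_pi_I_ne_zero h1).symm

theorem fourierCoeff_comp_neg (g : Γ → ℂ) (k : ℤ) :
    fourierCoeff (fun t => g (-t)) k = fourierCoeff g (-k) := by
  unfold fourierCoeff
  rw [← integral_neg_eq_self]
  refine integral_congr_ae (Eventually.of_forall fun t => ?_)
  simp only [neg_neg]
  congr 1
  rw [fourier_apply, fourier_apply, smul_neg, neg_smul, neg_neg]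

/-! ### Exterior functions, reduced to the disc by `z ↦ z⁻¹` -/

section exterior

variable {G : ℂ → ℂ} {L : ℂ}

theorem exterior_inversion (hc : ContinuousOn G {z | 1 ≤ ‖z‖})
    (hd : ∀ z : ℂ, 1 < ‖z‖ → DifferentiableAt ℂ G z)
    (hL : Tendsto G (Bornology.cobounded ℂ) (𝓝 L)) :
    ContinuousOn (Function.update (fun w => G w⁻¹) 0 L) (Metric.closedBall 0 1) ∧
      ∀ z ∈ Metric.ball (0 : ℂ) 1 \ {0},
        DifferentiableAt ℂ (Function.update (fun w => G w⁻¹) 0 L) z := by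
  have hev : ∀ z : ℂ, z ≠ 0 → Function.update (fun w => G w⁻¹) 0 L =ᶠ[𝓝 z] fun w => G w⁻¹ :=
    fun z hz => (eventually_ne_nhds hz).mono fun w hw => Function.update_of_ne hw _ _
  refine ⟨fun z hz => ?_, fun z hz => ?_⟩
  · by_cases hz0 : z = 0
    · subst hz0
      refine ContinuousAt.continuousWithinAt ?_
      rw [continuousAt_update_same]
      exact hL.comp tendsto_inv₀_nhdsNE_zero
    · refine ContinuousWithinAt.congr_of_eventuallyEq (f := fun w => G w⁻¹) ?_
        (mem_nhdsWithin_of_mem_nhds (hev z hz0)) (Function.update_of_ne hz0 _ _)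
      have h1 : ∀ w : ℂ, w ≠ 0 → ‖w‖ ≤ 1 → 1 ≤ ‖w⁻¹‖ := fun w hw hw1 => by
        rw [norm_inv]
        exact (one_le_inv₀ (norm_pos_iff.2 hw)).2 hw1
      have h2 : ContinuousWithinAt (fun w => G w⁻¹) (Metric.closedBall 0 1 \ {0}) z := by
        refine ContinuousWithinAt.comp (t := {z | 1 ≤ ‖z‖})
          (hc _ (h1 z hz0 (mem_closedBall_zero_iff.1 hz))) (continuousAt_inv₀ hz0).continuousWithinAt
          fun w hw => h1 w hw.2 (mem_closedBall_zero_iff.1 hw.1)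
      refine h2.mono_of_mem_nhdsWithin ?_
      exact inter_mem self_mem_nhdsWithin
        (mem_nhdsWithin_of_mem_nhds (isOpen_compl_singleton.mem_nhds hz0))
  · have hz0 : z ≠ 0 := hz.2
    refine DifferentiableAt.congr_of_eventuallyEq ?_ (hev z hz0)
    refine DifferentiableAt.comp z (hd _ ?_) (differentiableAt_inv hz0)
    rw [norm_inv]
    exact (one_lt_inv₀ (norm_pos_iff.2 hz0)).2 (mem_ball_zero_iff.1 hz.1)

theorem onCircle_inversion (G : ℂ → ℂ) (L : ℂ) :
    onCircle G = fun t => onCircle (Function.update (fun w => G w⁻¹) 0 L) (-t) := by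
  funext t
  simp only [onCircle]
  rw [Function.update_of_ne (Circle.coe_ne_zero _), AddCircle.toCircle_neg, Circle.coe_inv, inv_inv]

theorem fourierCoeff_onCircle_exterior_of_pos (hc : ContinuousOn G {z | 1 ≤ ‖z‖})
    (hd : ∀ z : ℂ, 1 < ‖z‖ → DifferentiableAt ℂ G z)
    (hL : Tendsto G (Bornology.cobounded ℂ) (𝓝 L)) {k : ℤ} (hk : 0 < k) :
    fourierCoeff (onCircle G) k = 0 := by
  obtain ⟨h1, h2⟩ := exterior_inversion hc hd hL
  rw [onCircle_inversion G L, fourierCoeff_comp_neg]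
  exact fourierCoeff_onCircle_of_neg h1 h2 (neg_lt_zero.2 hk)

theorem fourierCoeff_onCircle_exterior_zero (hc : ContinuousOn G {z | 1 ≤ ‖z‖})
    (hd : ∀ z : ℂ, 1 < ‖z‖ → DifferentiableAt ℂ G z)
    (hL : Tendsto G (Bornology.cobounded ℂ) (𝓝 L)) : fourierCoeff (onCircle G) 0 = L := by
  obtain ⟨h1, h2⟩ := exterior_inversion hc hd hL
  rw [onCircle_inversion G L, fourierCoeff_comp_neg, neg_zero, fourierCoeff_onCircle_zero h1 h2,
    Function.update_self]

end exterior

theorem continuous_onCircle {F : ℂ → ℂ} {S : Set ℂ} (hF : ContinuousOn F S)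
    (hS : ∀ z : ℂ, ‖z‖ = 1 → z ∈ S) : Continuous (onCircle F) :=
  hF.comp_continuous (continuous_subtype_val.comp AddCircle.continuous_toCircle)
    fun _ => hS _ (Circle.norm_coe _)

theorem onCircle_eq_one_of_fourierCoeff {F : ℂ → ℂ} (hF : Continuous (onCircle F))
    (h0 : fourierCoeff (onCircle F) 0 = 1) (hk : ∀ k ≠ 0, fourierCoeff (onCircle F) k = 0) (t : Γ) :
    onCircle F t = 1 := by
  have : (⟨onCircle F, hF⟩ : C(Γ, ℂ)) = fourier 0 := by
    refine continuousMap_ext_of_fourierCoeff fun k => ?_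
    rw [fourierCoeff_fourier_apply, ContinuousMap.coe_mk]
    split_ifs with hk0
    · rw [hk0, h0]
    · exact hk k hk0
  have := DFunLike.congr_fun this t
  simpa using this

theorem setOf_one_le_norm_subset : {z : ℂ | 1 ≤ ‖z‖} ⊆ closure {z : ℂ | 1 < ‖z‖} := by
  intro z hz
  have hs : Tendsto (fun r : ℝ => (r : ℂ) * z) (𝓝[>] 1) (𝓝 z) := by
    have : Continuous fun r : ℝ => (r : ℂ) * z := by fun_prop
    have h1 := this.tendsto 1
    simp only [Complex.ofReal_one, one_mul] at h1
    exact h1.mono_left nhdsWithin_le_nhds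
  refine mem_closure_of_tendsto hs (eventually_mem_nhdsWithin.mono fun r hr => ?_)
  have hr1 : (1 : ℝ) < r := hr
  have hz1 : 1 ≤ ‖z‖ := hz
  simp only [Set.mem_ofPred_eq, norm_mul, Complex.norm_real, Real.norm_eq_abs]
  rw [abs_of_pos (by linarith)]
  nlinarith

/-- Uniqueness of the Wiener-Hopf factorization, on the unit circle. -/
theorem IsWienerHopf.onCircle_eq {h : IsBeurlingWeight ν} {φ : Γ → ℂ} {φp φm : ℂ → ℂ}
    (hφ : IsWienerHopf φ φp φm) {p p' m m' : BAlg h}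
    (hp' : p' ∈ BAlg.supported h nonnegInt) (hm : m ∈ BAlg.supported h nonposInt)
    (hpp : p * p' = 1) (hmm : m * m' = 1) (hm1 : BAlg.coeff 0 m = 1)
    (he : φ =ᵐ[μΓ] BAlg.toC (p * m)) :
    onCircle φp = BAlg.toC p ∧ onCircle φm = BAlg.toC m ∧
      onCircle φp⁻¹ = BAlg.toC p' ∧ onCircle φm⁻¹ = BAlg.toC m' := by
  have hvp : ∀ t, BAlg.toC p t * BAlg.toC p' t = 1 := fun t => by
    rw [← ContinuousMap.mul_apply, ← map_mul, hpp, map_one, ContinuousMap.one_apply]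
  have hvm : ∀ t, BAlg.toC m t * BAlg.toC m' t = 1 := fun t => by
    rw [← ContinuousMap.mul_apply, ← map_mul, hmm, map_one, ContinuousMap.one_apply]
  have hop : IsOpen {z : ℂ | 1 < ‖z‖} := isOpen_lt continuous_const continuous_norm
  have hφpc : ContinuousOn φp (Metric.closedBall 0 1) := by
    have := hφ.plus_analytic.continuousOn
    rwa [closure_ball _ one_ne_zero] at this
  have hφmc : ContinuousOn φm {z | 1 ≤ ‖z‖} :=
    hφ.minus_analytic.continuousOn.mono setOf_one_le_norm_subset
  have hφp0 : ∀ t, onCircle φp t ≠ 0 := fun t => hφ.plus_ne_zero _ (Circle.norm_coe _).le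
  have hφm0 : ∀ t, onCircle φm t ≠ 0 := fun t => hφ.minus_ne_zero _ (Circle.norm_coe _).ge
  -- Liouville's argument in Fourier form. On the circle `p m = φ₊ φ₋` reads `p' φ₊ = m / φ₋`. The
  -- left side has no negative frequencies, the right side no positive ones and mean `1`, so both
  -- are identically `1`.
  let F : ℂ → ℂ := fun z => laurentExt (BAlg.toC p') z * φp z
  let G : ℂ → ℂ := fun z => laurentExt (BAlg.toC m) z * (φm z)⁻¹
  have hFc : ContinuousOn F (Metric.closedBall 0 1) :=
    (BAlg.continuousOn_laurentExt fun z hz =>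
      BAlg.dominated_of_nonneg hp' (mem_closedBall_zero_iff.1 hz)).mul hφpc
  have hFd : ∀ z ∈ Metric.ball (0 : ℂ) 1 \ {0}, DifferentiableAt ℂ F z := fun z hz =>
    ((BAlg.differentiableOn_laurentExt Metric.isOpen_ball fun w hw =>
      BAlg.dominated_of_nonneg hp' (mem_ball_zero_iff.1 hw).le).differentiableAt
        (Metric.isOpen_ball.mem_nhds hz.1)).mul
      (hφ.plus_analytic.differentiableAt Metric.isOpen_ball hz.1)
  have hGc : ContinuousOn G {z | 1 ≤ ‖z‖} :=
    (BAlg.continuousOn_laurentExt fun z hz => BAlg.dominated_of_nonpos hm hz).mul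
      (hφmc.inv₀ fun z hz => hφ.minus_ne_zero z hz)
  have hGd : ∀ z : ℂ, 1 < ‖z‖ → DifferentiableAt ℂ G z := fun z hz =>
    ((BAlg.differentiableOn_laurentExt hop fun w hw =>
      BAlg.dominated_of_nonpos hm (le_of_lt hw)).differentiableAt (hop.mem_nhds hz)).mul
      ((hφ.minus_analytic.differentiableAt hop hz).inv (hφ.minus_ne_zero z (le_of_lt hz)))
  have hGL : Tendsto G (Bornology.cobounded ℂ) (𝓝 1) := by
    have h1 := BAlg.tendsto_laurentExt_cobounded hm
    rw [hm1] at h1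
    simpa using h1.mul (hφ.minus_infty.inv₀ one_ne_zero)
  have hFv : ∀ t, onCircle F t = BAlg.toC p' t * onCircle φp t := fun t => by
    rw [← BAlg.onCircle_laurentExt]; rfl
  have hGv : ∀ t, onCircle G t = BAlg.toC m t * (onCircle φm t)⁻¹ := fun t => by
    rw [← BAlg.onCircle_laurentExt]; rfl
  have hFG : onCircle F =ᵐ[μΓ] onCircle G := by
    filter_upwards [he, hφ.eq_mul] with t h1 h2
    rw [hFv, hGv, eq_mul_inv_iff_mul_eq₀ (hφm0 t), mul_assoc, ← h2, h1, map_mul,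
      ContinuousMap.mul_apply, ← mul_assoc, mul_comm (BAlg.toC p' t), hvp, one_mul]
  have hco : ∀ k, fourierCoeff (onCircle F) k = fourierCoeff (onCircle G) k := fun k =>
    congrFun (fourierCoeff_congr_ae hFG) k
  have hG0 : fourierCoeff (onCircle G) 0 = 1 := fourierCoeff_onCircle_exterior_zero hGc hGd hGL
  have hGk : ∀ k ≠ 0, fourierCoeff (onCircle G) k = 0 := by
    intro k hk
    rcases lt_or_gt_of_ne hk with h1 | h1
    · rw [← hco]
      exact fourierCoeff_onCircle_of_neg hFc hFd h1
    · exact fourierCoeff_onCircle_exterior_of_pos hGc hGd hGL h1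
  have hF1 := onCircle_eq_one_of_fourierCoeff
    (continuous_onCircle hFc fun z hz => mem_closedBall_zero_iff.2 hz.le)
    ((hco 0).trans hG0) fun k hk => (hco k).trans (hGk k hk)
  have hG1 := onCircle_eq_one_of_fourierCoeff (continuous_onCircle hGc fun z hz => hz.ge) hG0 hGk
  have hφp : ∀ t, onCircle φp t = BAlg.toC p t := fun t => by
    have h1 := hF1 t
    rw [hFv] at h1
    calc onCircle φp t = BAlg.toC p t * BAlg.toC p' t * onCircle φp t := by rw [hvp, one_mul]
      _ = BAlg.toC p t := by rw [mul_assoc, h1, mul_one]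
  have hφm : ∀ t, onCircle φm t = BAlg.toC m t := fun t => by
    have h1 := hG1 t
    rw [hGv, mul_inv_eq_one₀ (hφm0 t)] at h1
    exact h1.symm
  refine ⟨funext hφp, funext hφm, funext fun t => ?_, funext fun t => ?_⟩
  · have h1 := hφp t
    simp only [onCircle, Pi.inv_apply] at h1 ⊢
    rw [h1]
    exact inv_eq_of_mul_eq_one_right (hvp t)
  · have h1 := hφm t
    simp only [onCircle, Pi.inv_apply] at h1 ⊢
    rw [h1]
    exact inv_eq_of_mul_eq_one_right (hvm t)

end

end BeurlingToeplitz

namespace BeurlingToeplitz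

noncomputable section

/-! ### Multiplication operators with continuous symbols -/

theorem toLinfty_congr {φ ψ : Γ → ℂ} (hφ : φ =ᵐ[μΓ] ψ) : toLinfty φ = toLinfty ψ := by
  unfold toLinfty
  by_cases h1 : MemLp φ ∞ μΓ
  · rw [dif_pos h1, dif_pos ((memLp_congr_ae hφ).1 h1)]
    exact MemLp.toLp_congr _ _ hφ
  · rw [dif_neg h1, dif_neg (fun h2 => h1 ((memLp_congr_ae hφ).2 h2))]

theorem toeplitz_congr {φ ψ : Γ → ℂ} (hφ : φ =ᵐ[μΓ] ψ) : toeplitz φ = toeplitz ψ := by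
  rw [toeplitz, toeplitz, toLinfty_congr hφ]

theorem memLp_top_continuousMap (f : C(Γ, ℂ)) : MemLp f ∞ μΓ :=
  memLp_top_of_bound f.continuous.aestronglyMeasurable ‖f‖
    (Eventually.of_forall f.norm_coe_le_norm)

theorem coeFn_mulL2 (f : C(Γ, ℂ)) (u : L2) : mulL2 (toLinfty f) u =ᵐ[μΓ] fun t => f t * u t := by
  have h1 : toLinfty f = (memLp_top_continuousMap f).toLp f := dif_pos _
  have h2 := (ContinuousLinearMap.mul ℂ ℂ).coeFn_holder (r := 2) (toLinfty f) u
  have h3 : mulL2 (toLinfty f) u = (ContinuousLinearMap.mul ℂ ℂ).holder 2 (toLinfty f) u := rfl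
  rw [h3]
  filter_upwards [h2, (memLp_top_continuousMap f).coeFn_toLp] with t ht1 ht2
  rw [ht1, h1, ht2, ContinuousLinearMap.mul_apply']

theorem norm_mulL2_le (f : C(Γ, ℂ)) (u : L2) : ‖mulL2 (toLinfty f) u‖ ≤ ‖f‖ * ‖u‖ := by
  refine Lp.norm_le_mul_norm_of_ae_le_mul ?_
  filter_upwards [coeFn_mulL2 f u] with t ht
  rw [ht, norm_mul]
  exact mul_le_mul_of_nonneg_right (f.norm_coe_le_norm t) (norm_nonneg _)

theorem mulL2_mul (f g : C(Γ, ℂ)) (u : L2) :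
    mulL2 (toLinfty (f * g : C(Γ, ℂ))) u = mulL2 (toLinfty f) (mulL2 (toLinfty g) u) := by
  refine Lp.ext ?_
  filter_upwards [coeFn_mulL2 (f * g) u, coeFn_mulL2 f (mulL2 (toLinfty g) u),
    coeFn_mulL2 g u] with t h1 h2 h3
  rw [h1, h2, h3, ContinuousMap.mul_apply, mul_assoc]

theorem mulL2_one (u : L2) : mulL2 (toLinfty (1 : C(Γ, ℂ))) u = u := by
  refine Lp.ext ?_
  filter_upwards [coeFn_mulL2 1 u] with t h1
  rw [h1, ContinuousMap.one_apply, one_mul]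

theorem mulL2_add (f g : C(Γ, ℂ)) (u : L2) :
    mulL2 (toLinfty (f + g : C(Γ, ℂ))) u = mulL2 (toLinfty f) u + mulL2 (toLinfty g) u := by
  refine Lp.ext ?_
  filter_upwards [coeFn_mulL2 (f + g) u, coeFn_mulL2 f u, coeFn_mulL2 g u,
    Lp.coeFn_add (mulL2 (toLinfty f) u) (mulL2 (toLinfty g) u)] with t h1 h2 h3 h4
  rw [h1, h4, Pi.add_apply, h2, h3, ContinuousMap.add_apply, add_mul]

theorem mulL2_smul (c : ℂ) (f : C(Γ, ℂ)) (u : L2) :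
    mulL2 (toLinfty (c • f : C(Γ, ℂ))) u = c • mulL2 (toLinfty f) u := by
  refine Lp.ext ?_
  filter_upwards [coeFn_mulL2 (c • f) u, coeFn_mulL2 f u,
    Lp.coeFn_smul c (mulL2 (toLinfty f) u)] with t h1 h2 h3
  rw [h1, h3, Pi.smul_apply, h2, ContinuousMap.smul_apply, smul_mul_assoc]

theorem inner_mulL2_left (f : C(Γ, ℂ)) (u v : L2) :
    inner ℂ (mulL2 (toLinfty f) u) v = inner ℂ u (mulL2 (toLinfty (star f : C(Γ, ℂ))) v) := by
  rw [L2.inner_def, L2.inner_def]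
  refine integral_congr_ae ?_
  filter_upwards [coeFn_mulL2 f u, coeFn_mulL2 (star f) v] with t h1 h2
  rw [h1, h2]
  simp only [RCLike.inner_apply, map_mul, ContinuousMap.star_apply, RCLike.star_def]
  ring

theorem fourierCoeff_mulL2_fourier (j k : ℤ) (u : L2) :
    fourierCoeff (mulL2 (toLinfty (fourier j : C(Γ, ℂ))) u) k = fourierCoeff u (k - j) := by
  unfold fourierCoeff
  refine integral_congr_ae ?_
  filter_upwards [coeFn_mulL2 (fourier j) u] with t h1
  rw [h1, smul_eq_mul, smul_eq_mul, ← mul_assoc, ← fourier_add, show -(k - j) = -k + j by ring]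

theorem fourierCoeff_mulL2_zPow (f : C(Γ, ℂ)) (j k : ℤ) :
    fourierCoeff (mulL2 (toLinfty f) (zPow k)) j = fourierCoeff f (j - k) := by
  rw [← fourierCoeff_fourier_mul]
  refine congrFun (fourierCoeff_congr_ae ?_) j
  filter_upwards [coeFn_mulL2 f (zPow k), coeFn_fourierLp 2 k] with t h1 h2
  rw [h1, h2, ContinuousMap.mul_apply, mul_comm]

/-! ### Toeplitz operators with symbols in the Wiener algebra -/

theorem inner_monoH (j : ℕ) (u : Hplus) : inner ℂ (monoH j) u = fourierCoeff (u : L2) j := by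
  rw [fourierCoeff_eq_inner]; rfl

theorem Hplus_eq_sum {u : Hplus} {n : ℕ} (hu : ∀ k : ℕ, n < k → fourierCoeff (u : L2) k = 0) :
    (u : L2) ∈ polys n := by
  have h1 := hasSum_fourier_series_L2 (u : L2)
  have h2 : HasSum (fun i : ℤ => fourierCoeff (u : L2) i • zPow i)
      (∑ i ∈ (Finset.range (n + 1)).image (fun k : ℕ => (k : ℤ)), fourierCoeff (u : L2) i • zPow i) := by
    refine hasSum_sum_of_ne_finset_zero fun i hi => ?_
    have : fourierCoeff (u : L2) i = 0 := by
      by_cases hi0 : i < 0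
      · exact u.2 i hi0
      · lift i to ℕ using not_lt.1 hi0
        refine hu i ?_
        by_contra hn
        exact hi (Finset.mem_image_of_mem _ (Finset.mem_range.2 (by omega)))
    rw [this, zero_smul]
  rw [h1.unique h2]
  refine Submodule.sum_mem _ fun i hi => Submodule.smul_mem _ _ ?_
  obtain ⟨k, hk, rfl⟩ := Finset.mem_image.1 hi
  exact Submodule.subset_span ⟨⟨k, Finset.mem_range.1 hk⟩, rfl⟩

theorem Hplus_eq_zero {u : Hplus} (hu : ∀ k : ℕ, fourierCoeff (u : L2) k = 0) : u = 0 := by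
  have h1 := hasSum_fourier_series_L2 (u : L2)
  have h2 : ∀ i : ℤ, fourierCoeff (u : L2) i = 0 := fun i => by
    by_cases hi0 : i < 0
    · exact u.2 i hi0
    · lift i to ℕ using not_lt.1 hi0
      exact hu i
  simp only [h2, zero_smul] at h1
  exact Subtype.ext (h1.unique hasSum_zero)

namespace BAlg

/-- The Wiener algebra. -/
abbrev Wiener : Type := BAlg IsBeurlingWeight.one

/-- The Toeplitz operator of an element of the Wiener algebra. -/
def T (f : Wiener) : Hplus →L[ℂ] Hplus := toeplitz (toC f)

theorem T_apply (f : Wiener) (u : Hplus) :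
    T f u = Hplus.orthogonalProjectionOnto (mulL2 (toLinfty (toC f)) u) := rfl

theorem norm_toC_le (f : Wiener) : ‖toC f‖ ≤ ‖f‖ :=
  (ContinuousMap.norm_le _ (norm_nonneg _)).2 f.norm_toC_apply_le

theorem norm_T_le (f : Wiener) : ‖T f‖ ≤ ‖f‖ := by
  refine ContinuousLinearMap.opNorm_le_bound _ (norm_nonneg _) fun u => ?_
  rw [T_apply]
  exact (Submodule.norm_orthogonalProjectionOnto_apply_le _ _).trans
    ((norm_mulL2_le _ _).trans (mul_le_mul_of_nonneg_right f.norm_toC_le (norm_nonneg _)))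

theorem T_add (f g : Wiener) : T (f + g) = T f + T g := by
  ext1 u
  rw [add_apply, T_apply, T_apply, T_apply, map_add toC, mulL2_add, map_add]

theorem T_neg (f : Wiener) : T (-f) = -T f := by
  ext1 u
  rw [neg_apply, T_apply, T_apply, ← neg_one_smul ℂ f, map_smul toC, mulL2_smul,
    map_smul, neg_one_smul]

theorem T_sub (f g : Wiener) : T (f - g) = T f - T g := by
  rw [sub_eq_add_neg, T_add, T_neg, sub_eq_add_neg]

theorem T_one : T 1 = 1 := by
  ext1 u
  rw [T_apply, map_one toC, mulL2_one]
  exact Submodule.orthogonalProjectionOnto_mem_subspace_eq_self u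

/-- Multiplication by `z^j` with `j ≥ 0` preserves `H₊`. The general case follows since `H₊` is
closed and the Fourier series of `f` converges in norm. -/
theorem mulL2_mem_Hplus {f : Wiener} (hf : f ∈ supported _ nonnegInt) (u : Hplus) :
    mulL2 (toLinfty (toC f)) u ∈ Hplus := by
  let Φ : Wiener →ₗ[ℂ] L2 :=
    { toFun := fun g => mulL2 (toLinfty (toC g)) u
      map_add' := fun a b => by rw [map_add toC, mulL2_add]
      map_smul' := fun c a => by rw [map_smul toC, mulL2_smul, RingHom.id_apply] }
  have hΦ : Continuous Φ := AddMonoidHomClass.continuous_of_bound Φ ‖u‖ fun g => by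
    refine ((norm_mulL2_le _ _).trans
      (mul_le_mul_of_nonneg_right g.norm_toC_le (norm_nonneg _))).trans (le_of_eq ?_)
    exact mul_comm ‖g‖ ‖u‖
  have hs := f.hasSum_coeff_smul_mono.map Φ hΦ
  refine isClosed_Hplus.mem_of_tendsto hs (Eventually.of_forall fun F =>
    Submodule.sum_mem _ fun j _ => ?_)
  rw [Function.comp_apply, map_smul]
  by_cases hj : 0 ≤ j
  · refine Submodule.smul_mem _ _ fun k hk => ?_
    have h1 := fourierCoeff_mulL2_fourier j k u
    rw [u.2 (k - j) (by omega)] at h1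
    exact h1
  · rw [hf j hj, zero_smul]
    exact Submodule.zero_mem _

/-- For analytic `g` the product `g u` is already in `H₊`, so the inner projection does nothing. -/
theorem T_mul_of_nonneg (f : Wiener) {g : Wiener} (hg : g ∈ supported _ nonnegInt) :
    T (f * g) = T f * T g := by
  ext1 u
  have h1 : T g u = ⟨_, mulL2_mem_Hplus hg u⟩ :=
    Submodule.orthogonalProjectionOnto_mem_subspace_eq_self
      (⟨_, mulL2_mem_Hplus hg u⟩ : Hplus)
  rw [mul_apply_eq_comp, h1, T_apply, T_apply, map_mul toC, mulL2_mul]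

/-- Complex conjugation on the Wiener algebra. -/
def conj (f : Wiener) : Wiener := ofCoeff _ (a := fun j => star (coeff (-j) f)) (by
  have := (Equiv.neg ℤ).summable_iff.2 f.summable_coeff
  simpa [Function.comp_def] using this)

theorem coeff_conj (f : Wiener) (k : ℤ) : coeff k f.conj = star (coeff (-k) f) := coeff_ofCoeff _ k

theorem norm_conj (f : Wiener) : ‖f.conj‖ = ‖f‖ := by
  rw [norm_def, norm_def, ← (Equiv.neg ℤ).tsum_eq]
  refine tsum_congr fun j => ?_
  rw [coeff_conj, norm_star, Equiv.neg_apply, neg_neg]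

theorem toC_conj (f : Wiener) : toC f.conj = star (toC f) := by
  refine continuousMap_ext_of_fourierCoeff fun k => ?_
  rw [fourierCoeff_toC, coeff_conj, ← fourierCoeff_toC, fourierCoeff, fourierCoeff,
    RCLike.star_def, ← integral_conj]
  refine integral_congr_ae (Eventually.of_forall fun t => ?_)
  simp only [smul_eq_mul, map_mul, ContinuousMap.star_apply, RCLike.star_def, neg_neg]
  rw [fourier_neg]

theorem conj_mul (f g : Wiener) : (f * g).conj = f.conj * g.conj :=
  toC_injective (by rw [map_mul, toC_conj, toC_conj, toC_conj, map_mul, star_mul'])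

theorem conj_conj (f : Wiener) : f.conj.conj = f :=
  toC_injective (by rw [toC_conj, toC_conj, star_star])

theorem conj_mono (k : ℤ) : (mono k : Wiener).conj = mono (-k) := by
  ext j
  rw [coeff_conj, coeff_mono, coeff_mono]
  by_cases hj : j = -k
  · simp [hj]
  · rw [if_neg hj, if_neg (by omega), star_zero]

theorem conj_mem_nonneg {f : Wiener} (hf : f ∈ supported _ nonposInt) :
    f.conj ∈ supported _ nonnegInt := fun k hk => by
  rw [coeff_conj, hf _ (by rw [mem_nonnegInt] at hk; rw [mem_nonposInt]; omega), star_zero]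

theorem conj_mem_nonpos {f : Wiener} (hf : f ∈ supported _ nonnegInt) :
    f.conj ∈ supported _ nonposInt := fun k hk => by
  rw [coeff_conj, hf _ (by rw [mem_nonposInt] at hk; rw [mem_nonnegInt]; omega), star_zero]

theorem adjoint_T (f : Wiener) : ContinuousLinearMap.adjoint (T f) = T f.conj := by
  symm
  rw [ContinuousLinearMap.eq_adjoint_iff]
  intro u v
  rw [T_apply, T_apply, Submodule.inner_orthogonalProjectionOnto_eq_of_mem_right,
    Submodule.inner_orthogonalProjectionOnto_eq_of_mem_left, inner_mulL2_left, toC_conj, star_star]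

/-- The adjoint of `T_mul_of_nonneg`, as conjugation exchanges analytic and anti-analytic symbols.
-/
theorem T_mul_of_nonpos {f : Wiener} (hf : f ∈ supported _ nonposInt) (g : Wiener) :
    T (f * g) = T f * T g := by
  have h1 := T_mul_of_nonneg g.conj (conj_mem_nonneg hf)
  have h2 := congrArg ContinuousLinearMap.adjoint h1
  rw [ContinuousLinearMap.mul_def, ContinuousLinearMap.adjoint_comp, adjoint_T, adjoint_T,
    adjoint_T, conj_mul, conj_conj, conj_conj, mul_comm g f] at h2
  exact h2

theorem fourierCoeff_T_monoH (f : Wiener) (j k : ℕ) :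
    fourierCoeff (T f (monoH k) : L2) j = coeff (j - k) f := by
  rw [← inner_monoH, T_apply, Submodule.inner_orthogonalProjectionOnto_eq_of_mem_left,
    ← fourierCoeff_toC, ← fourierCoeff_mulL2_zPow, fourierCoeff_eq_inner]
  rfl

theorem T_mono_monoH (j k : ℕ) : T (mono j) (monoH k) = monoH (j + k) := by
  refine sub_eq_zero.1 (Hplus_eq_zero fun i => ?_)
  rw [← inner_monoH, inner_sub_right, inner_monoH, fourierCoeff_T_monoH, coeff_mono]
  have h1 : inner ℂ (monoH i) (monoH (j + k)) = if i = j + k then (1 : ℂ) else 0 := by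
    have := (orthonormal_iff_ite.1 (orthonormal_fourier (T := 2 * π))) (i : ℤ) ((j + k : ℕ) : ℤ)
    simp only [Nat.cast_inj] at this
    exact this
  rw [h1]
  by_cases hi : i = j + k
  · rw [if_pos hi, if_pos (by omega), sub_self]
  · rw [if_neg hi, if_neg (by omega), sub_self]

theorem T_monoH_zero_of_coeff {f : Wiener} (hf : ∀ k : ℤ, 0 ≤ k → coeff k f = 0) :
    T f (monoH 0) = 0 :=
  Hplus_eq_zero fun k => by rw [fourierCoeff_T_monoH]; exact hf _ (by simp)

theorem mono_mem_nonneg (k : ℕ) : (mono k : Wiener) ∈ supported _ nonnegInt := fun j hj => by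
  rw [coeff_mono, if_neg]
  rintro rfl
  exact hj (Int.natCast_nonneg k)

theorem mono_mem_nonpos (k : ℕ) : (mono (-k) : Wiener) ∈ supported _ nonposInt := fun j hj => by
  rw [coeff_mono, if_neg]
  rintro rfl
  exact hj (mem_nonposInt.2 (by omega))

theorem norm_mono_wiener (k : ℤ) : ‖(mono k : Wiener)‖ = 1 := norm_mono k

/-- The part of `f` with frequencies of modulus at least `n`. -/
def tail (n : ℕ) (f : Wiener) : Wiener := restrict {k | (n : ℤ) ≤ |k|} f

theorem coeff_sub_tail {n : ℕ} {f : Wiener} {k : ℤ} (hk : (n : ℤ) ≤ |k|) :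
    coeff k (f - tail n f) = 0 := by
  rw [map_sub, tail, coeff_restrict, Set.indicator_of_mem (s := {k : ℤ | (n : ℤ) ≤ |k|}) hk, sub_self]

theorem norm_tail_le (n : ℕ) (f : Wiener) : ‖tail n f‖ ≤ ‖f‖ := norm_restrict_le _ f

theorem norm_tail (n : ℕ) (f : Wiener) : ‖tail n f‖ = tailSeminorm (fun _ => 1) n (toC f) := by
  rw [tail, norm_restrict, tailSeminorm]
  refine Eq.trans (tsum_congr fun j => ?_)
    (tsum_subtype {k : ℤ | (n : ℤ) ≤ |k|} fun j => (1 : ℝ) * ‖fourierCoeff (toC f) j‖).symm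
  by_cases hj : (n : ℤ) ≤ |j|
  · rw [Set.indicator_of_mem (s := {k : ℤ | (n : ℤ) ≤ |k|}) hj,
      Set.indicator_of_mem (s := {k : ℤ | (n : ℤ) ≤ |k|}) hj]
    rfl
  · rw [Set.indicator_of_notMem (s := {k : ℤ | (n : ℤ) ≤ |k|}) hj,
      Set.indicator_of_notMem (s := {k : ℤ | (n : ℤ) ≤ |k|}) hj, norm_zero, mul_zero]

theorem norm_tail_conj (n : ℕ) (f : Wiener) : ‖tail n f.conj‖ = ‖tail n f‖ := by
  rw [← norm_conj]
  congr 1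
  ext k
  rw [coeff_conj, tail, tail, coeff_restrict, coeff_restrict]
  simp only [Set.indicator_apply, Set.mem_ofPred_eq, abs_neg, coeff_conj, neg_neg]
  split_ifs <;> simp

theorem tendsto_norm_tail (f : Wiener) : Tendsto (fun n => ‖tail n f‖) atTop (𝓝 0) := by
  simp only [tail, norm_restrict]
  rw [← tsum_zero (β := ℤ)]
  refine tendsto_tsum_of_dominated_convergence f.summable_norm_coeff (fun k => ?_)
    (Eventually.of_forall fun n k => ?_)
  · refine tendsto_const_nhds.congr' ((eventually_gt_atTop k.natAbs).mono fun n hn => ?_)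
    have hk : k ∉ {k : ℤ | (n : ℤ) ≤ |k|} := by
      rw [Set.mem_ofPred_eq, Int.abs_eq_natAbs]
      omega
    simp only [Set.indicator_of_notMem hk, norm_zero, mul_zero]
  · rw [one_mul, norm_norm]
    exact norm_indicator_le_norm_self _ _

end BAlg

end

end BeurlingToeplitz

namespace BeurlingToeplitz

noncomputable section

/-! ### Finite sections -/

open BAlg

/-- The compression of an operator on `H₊` to the polynomials of degree at most `n`. -/
def compress (n : ℕ) (A : Hplus →L[ℂ] Hplus) : polys n →L[ℂ] polys n :=
  (polys n).orthogonalProjectionOnto ∘L Hplus.subtypeL ∘L A ∘L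
    (polys n).subtypeL.codRestrict Hplus fun u => polys_le_Hplus n u.2

theorem compress_apply (n : ℕ) (A : Hplus →L[ℂ] Hplus) (u : polys n) :
    compress n A u =
      (polys n).orthogonalProjectionOnto (A ⟨u, polys_le_Hplus n u.2⟩ : L2) := rfl

theorem inner_monoP_compress (n : ℕ) (A : Hplus →L[ℂ] Hplus) (j k : Fin (n + 1)) :
    inner ℂ (monoP n j) (compress n A (monoP n k)) = inner ℂ (monoH j) (A (monoH k)) := by
  rw [compress_apply, Submodule.inner_orthogonalProjectionOnto_eq_of_mem_left]
  rfl

/-- The backward shift drops the coefficients of index at most `n` and keeps the others, so its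
kernel consists of polynomials. -/
theorem mem_polys_of_T_mono_eq_zero {n : ℕ} {u : Hplus}
    (hu : T (mono (-((n + 1 : ℕ) : ℤ))) u = 0) : (u : L2) ∈ polys n := by
  refine Hplus_eq_sum fun k hk => ?_
  obtain ⟨i, rfl⟩ := Nat.exists_eq_add_of_lt hk
  have h1 := inner_monoH i (T (mono (-((n + 1 : ℕ) : ℤ))) u)
  have h2 := fourierCoeff_mulL2_fourier (-((n + 1 : ℕ) : ℤ)) i (u : L2)
  rw [hu, inner_zero_right] at h1
  have h3 : inner ℂ (monoH i) (T (mono (-((n + 1 : ℕ) : ℤ))) u) =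
      fourierCoeff (mulL2 (toLinfty (fourier (-((n + 1 : ℕ) : ℤ)) : C(Γ, ℂ))) (u : L2)) i := by
    rw [T_apply, Submodule.inner_orthogonalProjectionOnto_eq_of_mem_left, fourierCoeff_eq_inner]
    rfl
  rw [hu, inner_zero_right, h2] at h3
  rw [h3]
  congr 1
  push_cast
  ring

theorem orthogonalProjectionOnto_polys_T_mono (n : ℕ) (u : Hplus) :
    (polys n).orthogonalProjectionOnto (T (mono ((n + 1 : ℕ) : ℤ)) u : L2) = 0 := by
  rw [Submodule.orthogonalProjectionOnto_eq_zero_iff, polys, Submodule.mem_orthogonal]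
  have hle : Submodule.span ℂ (Set.range fun j : Fin (n + 1) => zPow ((j : ℕ) : ℤ)) ≤
      (Submodule.span ℂ {(T (mono ((n + 1 : ℕ) : ℤ)) u : L2)})ᗮ := by
    refine Submodule.span_le.2 ?_
    rintro _ ⟨j, rfl⟩
    refine Submodule.mem_orthogonal_singleton_iff_inner_left.2 ?_
    have h1 : inner ℂ (monoH j) (T (mono ((n + 1 : ℕ) : ℤ)) u) =
        fourierCoeff (mulL2 (toLinfty (fourier ((n + 1 : ℕ) : ℤ) : C(Γ, ℂ))) (u : L2)) (j : ℕ) := by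
      rw [T_apply, Submodule.inner_orthogonalProjectionOnto_eq_of_mem_left, fourierCoeff_eq_inner]
      rfl
    rw [fourierCoeff_mulL2_fourier, u.2 _ (by have := j.2; omega)] at h1
    exact h1
  intro v hv
  exact Submodule.mem_orthogonal_singleton_iff_inner_left.1 (hle hv)

/-- The inverse of a finite section, through the inverse of the complementary section of the
inverse operator. -/
theorem compress_mul_compress {n : ℕ} {A B G : Hplus →L[ℂ] Hplus} (hAB : A * B = 1)
    (hG : T (mono (-((n + 1 : ℕ) : ℤ))) * B * T (mono ((n + 1 : ℕ) : ℤ)) * G = 1) :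
    compress n A * compress n
      (B - B * T (mono ((n + 1 : ℕ) : ℤ)) * G * T (mono (-((n + 1 : ℕ) : ℤ))) * B) = 1 := by
  set S := T (mono ((n + 1 : ℕ) : ℤ))
  set S' := T (mono (-((n + 1 : ℕ) : ℤ)))
  set C := B - B * S * G * S' * B with hC
  -- The correction is designed for this: `C` takes values in the polynomials of degree at most `n`,
  -- so compressing it on the left loses nothing.
  have h1 : S' * C = 0 := by
    calc S' * C = S' * B - (S' * B * S * G) * (S' * B) := by rw [hC]; simp only [mul_sub, mul_assoc]
      _ = 0 := by rw [hG, one_mul, sub_self]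
  -- The defect from the identity has range in `z^{n+1} H₊`, which `P_n` annihilates.
  have h2 : A * C = 1 - S * (G * S' * B) := by
    calc A * C = A * B - (A * B) * S * (G * S' * B) := by rw [hC]; simp only [mul_sub, mul_assoc]
      _ = _ := by rw [hAB, one_mul]
  ext1 u
  have hmem : (C ⟨u, polys_le_Hplus n u.2⟩ : L2) ∈ polys n :=
    mem_polys_of_T_mono_eq_zero (congrArg (fun X : Hplus →L[ℂ] Hplus => X ⟨u, _⟩) h1)
  have h3 : compress n C u = ⟨_, hmem⟩ :=
    Submodule.orthogonalProjectionOnto_mem_subspace_eq_self (⟨_, hmem⟩ : polys n)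
  rw [mul_apply_eq_comp, h3, compress_apply]
  have h4 : A (C ⟨u, polys_le_Hplus n u.2⟩) =
      ⟨u, polys_le_Hplus n u.2⟩ - S ((G * S' * B) ⟨u, polys_le_Hplus n u.2⟩) :=
    congrArg (fun X : Hplus →L[ℂ] Hplus => X ⟨u, polys_le_Hplus n u.2⟩) h2
  have h5 : (A (C ⟨u, polys_le_Hplus n u.2⟩) : L2) =
      (u : L2) - (S ((G * S' * B) ⟨u, polys_le_Hplus n u.2⟩) : L2) := congrArg Subtype.val h4
  change (polys n).orthogonalProjectionOnto (A (C ⟨u, polys_le_Hplus n u.2⟩) : L2) = u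
  rw [h5, map_sub, orthogonalProjectionOnto_polys_T_mono, sub_zero,
    Submodule.orthogonalProjectionOnto_mem_subspace_eq_self]

theorem continuousLinearMap_mul_eq_one_comm {E : Type*} [NormedAddCommGroup E] [NormedSpace ℂ E]
    [FiniteDimensional ℂ E] {X Y : E →L[ℂ] E} (hXY : X * Y = 1) : Y * X = 1 := by
  have h1 : (X : E →ₗ[ℂ] E) * (Y : E →ₗ[ℂ] E) = 1 := by
    ext u
    exact congrArg (fun Z : E →L[ℂ] E => Z u) hXY
  ext u
  exact congrArg (fun Z : E →ₗ[ℂ] E => Z u) (mul_eq_one_comm.1 h1)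

theorem inverse_eq_of_mul_eq_one {R : Type*} [Ring R] {x y : R} (h1 : x * y = 1) (h2 : y * x = 1) :
    Ring.inverse x = y :=
  Ring.inverse_unit ⟨x, y, h1, h2⟩

/-! ### The error estimate -/

section estimate

variable {p p' m m' : Wiener}

/-- Toeplitz factors come in the order `T m * T p`, the analytic symbol acting first; each is
inverted by its own kind of multiplicativity. -/
theorem T_mul_inverse (hp : p ∈ supported _ nonnegInt) (hp' : p' ∈ supported _ nonnegInt)
    (hm : m ∈ supported _ nonposInt) (hm' : m' ∈ supported _ nonposInt)
    (hpp : p * p' = 1) (hmm : m * m' = 1) :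
    T (p * m) * (T p' * T m') = 1 ∧ (T p' * T m') * T (p * m) = 1 := by
  have hmT : T m * T m' = 1 := by rw [← T_mul_of_nonpos hm, hmm, T_one]
  have hmT' : T m' * T m = 1 := by rw [← T_mul_of_nonpos hm', mul_comm m' m, hmm, T_one]
  have hpT : T p * T p' = 1 := by rw [← T_mul_of_nonneg p hp', hpp, T_one]
  have hpT' : T p' * T p = 1 := by rw [← T_mul_of_nonneg p' hp, mul_comm p' p, hpp, T_one]
  have h1 : T (p * m) = T m * T p := by rw [mul_comm p m, T_mul_of_nonneg m hp]
  rw [h1]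
  constructor
  · rw [mul_assoc, ← mul_assoc (T p), hpT, one_mul, hmT]
  · rw [mul_assoc, ← mul_assoc (T m'), hmT', one_mul, hpT']

theorem mono_mul_sub_tail_mem (p : Wiener) {n r : ℕ} (hr : r ≤ n) :
    mono (-(n : ℤ)) * (p - tail r p) ∈ supported _ nonposInt := by
  intro k hk
  rw [coeff_mono_mul]
  rw [mem_nonposInt, not_le] at hk
  refine coeff_sub_tail ?_
  rw [Int.abs_eq_natAbs]
  omega

/-- As `m` is anti-analytic, `T m` maps `z^k` to degree at most `k`. The part of `p` with
frequencies below `n - k` therefore produces only degrees below `n`, which `T(z^{-n})` kills. Only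
the tail of `p` is left. -/
theorem norm_T_column_le (p : Wiener) (hm : m ∈ supported _ nonposInt)
    {n k : ℕ} (hk : k ≤ n) :
    ‖T (mono (-(n : ℤ))) (T p (T m (monoH k)))‖ ≤ ‖tail (n - k) p‖ * ‖m‖ := by
  set t := tail (n - k) p with ht
  have h1 : T (mono (-(n : ℤ))) (T (p - t) (T m (monoH k))) = 0 := by
    have e1 : monoH k = T (mono k) (monoH 0) := by rw [T_mono_monoH, add_zero]
    -- The product collapses to one symbol: `z^k` is analytic on the right, while `z^{-n}` and
    -- `z^{-n} (p - t)` are anti-analytic on the left.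
    have e2 : T (mono (-(n : ℤ))) * T (p - t) * T m * T (mono k) =
        T (mono (-(n : ℤ)) * (p - t) * m * mono k) := by
      rw [T_mul_of_nonneg _ (mono_mem_nonneg k),
        T_mul_of_nonpos (mono_mul_sub_tail_mem p (Nat.sub_le n k)),
        T_mul_of_nonpos (mono_mem_nonpos n)]
    have e3 : T (mono (-(n : ℤ)) * (p - t) * m * mono k) (monoH 0) = 0 := by
      refine T_monoH_zero_of_coeff fun i hi => ?_
      rw [show mono (-(n : ℤ)) * (p - t) * m * mono k = mono (-(n : ℤ) + k) * ((p - t) * m) by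
        rw [mono_add]; ring, coeff_mono_mul, ← (hasSum_coeff_mul _ _ _).tsum_eq]
      refine (tsum_congr fun j => ?_).trans tsum_zero
      by_cases hj : ((n - k : ℕ) : ℤ) ≤ |j|
      · rw [coeff_sub_tail hj, zero_mul]
      · rw [hm _ (by rw [mem_nonposInt]; rw [Int.abs_eq_natAbs] at hj; omega), mul_zero]
    rw [e1, ← e3, ← e2]
    rfl
  have h2 : T p = T (p - t) + T t := by rw [← T_add, sub_add_cancel]
  rw [h2, add_apply, map_add, h1, zero_add]
  have hmon : ‖monoH k‖ = 1 := (orthonormal_fourier (T := 2 * π)).1 (k : ℤ)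
  calc ‖T (mono (-(n : ℤ))) (T t (T m (monoH k)))‖
      ≤ 1 * (‖t‖ * (‖m‖ * 1)) := by
        refine ((T _).le_of_opNorm_le ((norm_T_le _).trans (norm_mono_wiener _).le) _).trans ?_
        refine mul_le_mul_of_nonneg_left ?_ zero_le_one
        refine ((T t).le_of_opNorm_le (norm_T_le t) _).trans ?_
        refine mul_le_mul_of_nonneg_left ?_ (norm_nonneg _)
        exact ((T m).le_of_opNorm_le (norm_T_le m) _).trans (by rw [hmon])
    _ = ‖t‖ * ‖m‖ := by ring

/-- The complementary section of `T(p') T(m')` converges to `T(p' m')` in norm. -/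
theorem tendsto_complementary_section (p m : Wiener) :
    Tendsto (fun n : ℕ => T (mono (-(n : ℤ))) * (T p * T m) * T (mono (n : ℤ))) atTop
      (𝓝 (T (p * m))) := by
  refine (tendsto_iff_norm_sub_tendsto_zero (E := Hplus →L[ℂ] Hplus)).2 ?_
  have hb : ∀ n : ℕ, ‖T (mono (-(n : ℤ))) * (T p * T m) * T (mono (n : ℤ)) - T (p * m)‖ ≤
      2 * ‖m‖ * ‖tail n p‖ := by
    intro n
    set t := tail n p
    have e1 : T (mono (-(n : ℤ))) * (T p * T m) * T (mono (n : ℤ)) =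
        T (mono (-(n : ℤ)) * p) * T (m * mono n) := by
      rw [T_mul_of_nonneg _ (mono_mem_nonneg n), T_mul_of_nonpos (mono_mem_nonpos n)]
      simp only [mul_assoc]
    have e2 : T (mono (-(n : ℤ)) * p) =
        T (mono (-(n : ℤ)) * (p - t)) + T (mono (-(n : ℤ)) * t) := by
      rw [← T_add, ← mul_add, sub_add_cancel]
    -- Once the tail is removed, `z^{-n} (p - t)` is anti-analytic, the symbols multiply, and the
    -- powers of `z` cancel. Everything else carries a factor `t`.
    have e3 : T (mono (-(n : ℤ)) * (p - t)) * T (m * mono n) = T (p * m) - T (t * m) := by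
      rw [← T_mul_of_nonpos (mono_mul_sub_tail_mem p le_rfl), ← T_sub]
      congr 1
      calc mono (-(n : ℤ)) * (p - t) * (m * mono n)
          = (mono (-(n : ℤ)) * mono n) * ((p - t) * m) := by ring
        _ = p * m - t * m := by rw [← mono_add, neg_add_cancel, mono_zero]; ring
    rw [e1, e2, add_mul, e3]
    have h1 : ‖T (t * m)‖ ≤ ‖t‖ * ‖m‖ := (norm_T_le _).trans (norm_mul_le _ _)
    have h2 : ‖T (mono (-(n : ℤ)) * t) * T (m * mono n)‖ ≤ ‖t‖ * ‖m‖ := by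
      refine (ContinuousLinearMap.opNorm_comp_le _ _).trans
        (mul_le_mul ?_ ?_ (ContinuousLinearMap.opNorm_nonneg _) (norm_nonneg _))
      · refine (norm_T_le _).trans ((norm_mul_le _ _).trans ?_)
        rw [norm_mono_wiener, one_mul]
      · refine (norm_T_le _).trans ((norm_mul_le _ _).trans ?_)
        rw [norm_mono_wiener, mul_one]
    calc _ = ‖T (mono (-(n : ℤ)) * t) * T (m * mono n) - T (t * m)‖ := by congr 1; abel
      _ ≤ ‖t‖ * ‖m‖ + ‖t‖ * ‖m‖ := (norm_sub_le (E := Hplus →L[ℂ] Hplus) _ _).trans (add_le_add h2 h1)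
      _ = 2 * ‖m‖ * ‖t‖ := by ring
  refine squeeze_zero (fun n => norm_nonneg (E := Hplus →L[ℂ] Hplus) _) hb ?_
  simpa using (tendsto_norm_tail p).const_mul (2 * ‖m‖)

/-- The product of the tails comes from Cauchy–Schwarz: the column of `B` contributes the tail of
`p'`, the row that of `m'`, and the uniformly bounded `G` stands between them. -/
theorem exists_error_bound (hp : p ∈ supported _ nonnegInt) (hp' : p' ∈ supported _ nonnegInt)
    (hm : m ∈ supported _ nonposInt) (hm' : m' ∈ supported _ nonposInt)
    (hpp : p * p' = 1) (hmm : m * m' = 1) {φ : Γ → ℂ} (hφ : toeplitz φ = T (p * m)) :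
    IsUnit (toeplitz φ) ∧ ∃ (c : ℝ) (N : ℕ), 0 ≤ c ∧ ∀ n ≥ N, IsUnit (truncToeplitz n φ) ∧
      ∀ j k : Fin (n + 1), ‖truncInvEntry n φ j k - toeplitzInvEntry φ j k‖ ≤
        c * (‖tail (n + 1 - k) p'‖ * ‖tail (n + 1 - j) m'‖) := by
  obtain ⟨hAB, hBA⟩ := T_mul_inverse hp hp' hm hm' hpp hmm
  -- With the roles of factors and inverses exchanged: the limit `T(p' m')` of the complementary
  -- sections is invertible.
  obtain ⟨hD1, hD2⟩ := T_mul_inverse hp' hp hm' hm (by rw [mul_comm p' p, hpp])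
    (by rw [mul_comm m' m, hmm])
  set B := T p' * T m' with hB
  rw [← hφ] at hAB hBA
  have hinv : Ring.inverse (toeplitz φ) = B := inverse_eq_of_mul_eq_one hAB hBA
  -- The shift to `n + 1` is needed because the complement of the polynomials of degree at most `n`
  -- starts at `z^{n+1}`. Invertibility is an open condition and inversion is continuous, so `N` and
  -- the bound on `G` both come from this limit.
  have hlim := (tendsto_complementary_section p' m').comp (tendsto_add_atTop_nat 1)
  have hunit : ∀ᶠ n : ℕ in atTop, IsUnit
      (T (mono (-((n + 1 : ℕ) : ℤ))) * B * T (mono ((n + 1 : ℕ) : ℤ))) :=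
    hlim.eventually (Units.nhds (R := Hplus →L[ℂ] Hplus) ⟨T (p' * m'), T p * T m, hD1, hD2⟩)
  have hinvlim : Tendsto (fun n : ℕ => Ring.inverse
      (T (mono (-((n + 1 : ℕ) : ℤ))) * B * T (mono ((n + 1 : ℕ) : ℤ)))) atTop
      (𝓝 (Ring.inverse (T (p' * m')))) :=
    (NormedRing.inverse_continuousAt (R := Hplus →L[ℂ] Hplus)
      ⟨T (p' * m'), T p * T m, hD1, hD2⟩).tendsto.comp hlim
  have hnorm : ∀ᶠ n : ℕ in atTop, ‖Ring.inverse
      (T (mono (-((n + 1 : ℕ) : ℤ))) * B * T (mono ((n + 1 : ℕ) : ℤ)))‖ <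
        ‖Ring.inverse (T (p' * m'))‖ + 1 :=
    ((continuous_norm (E := Hplus →L[ℂ] Hplus)).continuousAt.tendsto.comp
      hinvlim).eventually_lt_const (lt_add_one _)
  obtain ⟨N, hN⟩ := eventually_atTop.1 (hunit.and hnorm)
  refine ⟨⟨⟨_, B, hAB, hBA⟩, rfl⟩, (‖Ring.inverse (T (p' * m'))‖ + 1) * (‖m'‖ * ‖p'‖), N,
    by positivity, fun n hn => ?_⟩
  obtain ⟨hu, hK⟩ := hN n hn
  set S := T (mono ((n + 1 : ℕ) : ℤ)) with hS
  set S' := T (mono (-((n + 1 : ℕ) : ℤ))) with hS'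
  set G := Ring.inverse (S' * B * S)
  have hG : S' * B * S * G = 1 := Ring.mul_inverse_cancel _ hu
  have h1 := compress_mul_compress hAB hG
  have h2 := continuousLinearMap_mul_eq_one_comm h1
  have htinv : Ring.inverse (truncToeplitz n φ) = compress n (B - B * S * G * S' * B) :=
    inverse_eq_of_mul_eq_one h1 h2
  refine ⟨⟨⟨_, _, h1, h2⟩, rfl⟩, fun j k => ?_⟩
  have hcol : ‖S' (B (monoH k))‖ ≤ ‖tail (n + 1 - k) p'‖ * ‖m'‖ :=
    norm_T_column_le p' hm' k.2.le
  -- `B*` is again an analytic Toeplitz operator after an anti-analytic one, with symbols the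
  -- conjugates of `m'` and `p'`, so the column estimate applies.
  have hrow : ‖S' (ContinuousLinearMap.adjoint B (monoH j))‖ ≤ ‖tail (n + 1 - j) m'‖ * ‖p'‖ := by
    rw [hB, ContinuousLinearMap.mul_def, ContinuousLinearMap.adjoint_comp, adjoint_T, adjoint_T,
      ← norm_tail_conj, ← norm_conj p']
    exact norm_T_column_le m'.conj (conj_mem_nonpos hp') j.2.le
  have hadj : ContinuousLinearMap.adjoint S' = S := by
    rw [hS', adjoint_T, conj_mono, neg_neg]
  -- The difference is the entry of `-B S G S' B`; the left factor `B S` moves across the inner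
  -- product, using `S'* = S`.
  have hentry : truncInvEntry n φ j k - toeplitzInvEntry φ j k =
      -inner ℂ (S' (ContinuousLinearMap.adjoint B (monoH j))) (G (S' (B (monoH k)))) := by
    rw [truncInvEntry, htinv, inner_monoP_compress, toeplitzInvEntry, hinv, sub_apply,
      inner_sub_right, sub_sub_cancel_left]
    congr 1
    rw [← ContinuousLinearMap.adjoint_inner_right, hadj, ContinuousLinearMap.adjoint_inner_left]
    rfl
  rw [hentry, norm_neg]
  calc _ ≤ (‖tail (n + 1 - j) m'‖ * ‖p'‖) *
        ((‖Ring.inverse (T (p' * m'))‖ + 1) * (‖tail (n + 1 - k) p'‖ * ‖m'‖)) := by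
        refine (norm_inner_le_norm _ _).trans (mul_le_mul hrow ?_ (norm_nonneg _) (by positivity))
        refine (G.le_of_opNorm_le hK.le _).trans ?_
        exact mul_le_mul_of_nonneg_left hcol (by positivity)
    _ = _ := by ring

end estimate

/-! ### The main theorem -/

theorem fourierCoeff_sub {f g : Γ → ℂ} (hf : Integrable f μΓ) (hg : Integrable g μΓ) (k : ℤ) :
    fourierCoeff (f - g) k = fourierCoeff f k - fourierCoeff g k := by
  unfold fourierCoeff
  rw [← integral_sub (hf.fourier_smul _) (hg.fourier_smul _)]
  exact integral_congr_ae (Eventually.of_forall fun t => smul_sub _ _ _)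

/-- The continuous function with the coefficients of `φ` agrees with `φ` almost everywhere, by
uniqueness of Fourier coefficients in `L¹`. -/
theorem BAlg.exists_toC_ae_eq {ν : ℤ → ℝ} (h : IsBeurlingWeight ν) {φ : Γ → ℂ}
    (hφ : φ ∈ beurlingClass ν) : ∃ f : BAlg h, φ =ᵐ[μΓ] toC f ∧ laurentExt φ = laurentExt (toC f) := by
  obtain ⟨hi, hs⟩ := hφ
  have hc : ∀ k, fourierCoeff (toC (ofCoeff h hs)) k = fourierCoeff φ k :=
    fun k => coeff_ofCoeff hs k
  refine ⟨ofCoeff h hs, ?_, ?_⟩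
  · have hg := integrable_continuousMap (toC (ofCoeff h hs))
    have h1 := ae_eq_zero_of_fourierCoeff_eq_zero (hi.sub hg) fun k => by
      rw [fourierCoeff_sub hi hg, hc, sub_self]
    filter_upwards [h1] with t ht
    exact sub_eq_zero.1 ht
  · funext z
    exact tsum_congr fun j => by rw [hc]

theorem BAlg.toC_mem_beurlingClass {ν : ℤ → ℝ} {h : IsBeurlingWeight ν} (f : BAlg h) :
    ⇑(toC f) ∈ beurlingClass ν :=
  ⟨integrable_continuousMap _, f.summable_coeff⟩

/-- Converts membership in `W_ν` into decay of the unweighted tails; `f` and `g` are one function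
seen in two algebras. -/
theorem BAlg.norm_tail_mul_le {ν : ℤ → ℝ} {h : IsBeurlingWeight ν} {f : BAlg h} {g : Wiener}
    (hfg : ⇑(toC f) = toC g) {n : ℕ} {w : ℝ} (hw : ∀ k : ℤ, (n : ℤ) ≤ |k| → w ≤ ν k) :
    ‖tail n g‖ * w ≤ ‖f‖ := by
  rw [tail, norm_restrict, norm_def, ← tsum_mul_right]
  have hc : ∀ k, coeff k g = coeff k f := fun k => by
    rw [← fourierCoeff_toC, ← hfg, fourierCoeff_toC]
  refine Summable.tsum_le_tsum (fun k => ?_) ((summable_indicator _ g).mul_right w)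
    f.summable_coeff
  rw [one_mul]
  by_cases hk : (n : ℤ) ≤ |k|
  · rw [Set.indicator_of_mem (s := {k : ℤ | (n : ℤ) ≤ |k|}) hk, hc, mul_comm]
    exact mul_le_mul_of_nonneg_right (hw k hk) (norm_nonneg _)
  · rw [Set.indicator_of_notMem (s := {k : ℤ | (n : ℤ) ≤ |k|}) hk, norm_zero, zero_mul]
    exact mul_nonneg (h.pos k).le (norm_nonneg _)

/-- Either factor of `a * b` may be replaced by its crude bound `L₁` or `L₂`, keeping the decay of
the other; adding the two constants covers both cases of the minimum. -/
theorem le_mul_min_of_le_mul {x c a b α β K₁ K₂ L₁ L₂ : ℝ} (hc : 0 ≤ c) (ha : 0 ≤ a) (hb : 0 ≤ b)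
    (hα : 0 ≤ α) (hβ : 0 ≤ β) (hK₁ : 0 ≤ K₁) (hK₂ : 0 ≤ K₂) (hx : x ≤ c * (a * b))
    (haα : a ≤ K₁ * α) (hbβ : b ≤ K₂ * β) (haL : a ≤ L₁) (hbL : b ≤ L₂) :
    x ≤ c * (K₁ * L₂ + L₁ * K₂) * min α β := by
  have hL₁ : 0 ≤ L₁ := ha.trans haL
  have hL₂ : 0 ≤ L₂ := hb.trans hbL
  have h1 : a * b ≤ K₁ * α * L₂ := mul_le_mul haα hbL hb (by positivity)
  have h2 : a * b ≤ L₁ * (K₂ * β) := mul_le_mul haL hbβ hb hL₁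
  rcases min_choice α β with h | h <;> rw [h] <;> refine hx.trans ?_ <;> rw [mul_assoc] <;>
    refine mul_le_mul_of_nonneg_left ?_ hc
  · have : 0 ≤ L₁ * K₂ * α := by positivity
    linarith
  · have : 0 ≤ K₁ * L₂ * β := by positivity
    linarith

/-- For the trivial weight the annulus is the unit circle, so the hypotheses for any `ν` imply those
for the Wiener algebra. -/
theorem annulus_one_subset {ν : ℤ → ℝ} (h : IsBeurlingWeight ν) :
    annulus (fun _ => 1) ⊆ annulus ν := by
  have h1 : growthRate (fun _ => 1) = 0 :=
    tendsto_nhds_unique IsBeurlingWeight.one.tendsto_growthRate (by simp)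
  have h2 := growthRate_nonneg h
  rintro z ⟨hz1, hz2⟩
  rw [h1] at hz1 hz2
  exact ⟨(Real.exp_le_exp.2 (by linarith)).trans hz1, hz2.trans (Real.exp_le_exp.2 h2)⟩

theorem beurlingClass_subset_one {ν : ℤ → ℝ} (h : IsBeurlingWeight ν) {φ : Γ → ℂ}
    (hφ : φ ∈ beurlingClass ν) : φ ∈ beurlingClass fun _ => 1 :=
  ⟨hφ.1, by simpa using h.summable_norm hφ.2⟩

end

end BeurlingToeplitz

open BeurlingToeplitz
theorem theorem1 (φ : Γ → ℂ) :
    ∃ (c : ℝ) (N : ℕ), ∀ ν : ℤ → ℝ, IsBeurlingWeight ν → φ ∈ beurlingClass ν →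
      (∀ z ∈ annulus ν, laurentExt φ z ≠ 0) → HasWindingNumber (laurentExt φ) 0 →
      -- the objects in the statement exist
      IsUnit (toeplitz φ) ∧
      (∃ φp φm : ℂ → ℂ, IsWienerHopf φ φp φm) ∧
      (∀ φp φm : ℂ → ℂ, IsWienerHopf φ φp φm →
        onCircle φp ∈ beurlingClass ν ∧ onCircle φm ∈ beurlingClass ν ∧
        onCircle φp⁻¹ ∈ beurlingClass ν ∧ onCircle φm⁻¹ ∈ beurlingClass ν) ∧
      -- the truncations are invertible for large `n`
      (∀ n ≥ N, IsUnit (truncToeplitz n φ)) ∧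
      -- the error estimate in terms of the Wiener-Hopf factors, with `c` depending on `φ` only
      (∀ φp φm : ℂ → ℂ, IsWienerHopf φ φp φm → ∀ n ≥ N, ∀ j k : Fin (n + 1),
        ‖truncInvEntry n φ j k - toeplitzInvEntry φ j k‖ ≤
          c * min (tripleSeminorm (fun _ => 1) (n + 1 - k) φp φm)
            (tripleSeminorm (fun _ => 1) (n + 1 - j) φp φm)) ∧
      -- exponential decay
      (0 < growthRate ν → ∃ C : ℝ, ∀ n ≥ N, ∀ j k : Fin (n + 1),
        ‖truncInvEntry n φ j k - toeplitzInvEntry φ j k‖ ≤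
          C * min (Real.exp (-((n + 1 - k : ℕ) * growthRate ν)))
            (Real.exp (-((n + 1 - j : ℕ) * growthRate ν)))) ∧
      -- increasing weights
      ((∀ j k : ℤ, 0 ≤ j → j < k → ν j ≤ ν k) → ∃ C : ℝ, ∀ n ≥ N, ∀ j k : Fin (n + 1),
        ‖truncInvEntry n φ j k - toeplitzInvEntry φ j k‖ ≤
          C * min (ν (n + 1 - k : ℕ))⁻¹ (ν (n + 1 - j : ℕ))⁻¹) := by
  -- The constants are chosen before the weight. If no weight is admissible for `φ`, any choice will
  -- do.
  by_cases hyp : ∃ ν : ℤ → ℝ, IsBeurlingWeight ν ∧ φ ∈ beurlingClass ν ∧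
      (∀ z ∈ annulus ν, laurentExt φ z ≠ 0) ∧ HasWindingNumber (laurentExt φ) 0
  swap
  · exact ⟨0, 0, fun ν h1 h2 h3 h4 => absurd ⟨ν, h1, h2, h3, h4⟩ hyp⟩
  obtain ⟨ν₀, hν₀, hφ₀, hnz₀, hw⟩ := hyp
  -- Factoring in the Wiener algebra makes `c` and `N` independent of `ν`; the weight `ν₀` only
  -- supplies the hypotheses.
  obtain ⟨f, hf, hfL⟩ := BAlg.exists_toC_ae_eq IsBeurlingWeight.one
    (beurlingClass_subset_one hν₀ hφ₀)
  obtain ⟨p, hp, p', hp', m, hm, m', hm', hpp, hmm, hm1, rfl⟩ := BAlg.exists_wienerHopf (f := f)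
    (by rw [← hfL]; exact fun z hz => hnz₀ z (annulus_one_subset hν₀ hz)) (by rwa [← hfL])
  obtain ⟨hunit, c, N, hc, hN⟩ := exists_error_bound hp hp' hm hm' hpp hmm (toeplitz_congr hf)
  have hWH := BAlg.isWienerHopf_laurentExt hp hp' hm hm' hpp hmm hm1 hf
  -- The form produced by `le_mul_min_of_le_mul` with `K₁ = K₂ = 1`, `L₁ = ‖p'‖` and `L₂ = ‖m'‖`.
  refine ⟨c * (1 * ‖m'‖ + ‖p'‖ * 1), N, fun ν hν hφ hnz _ => ?_⟩
  obtain ⟨g, hg, hgL⟩ := BAlg.exists_toC_ae_eq hν hφ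
  obtain ⟨P, hP, P', hP', M, hM, M', hM', hPP, hMM, hM1, rfl⟩ := BAlg.exists_wienerHopf (f := g)
    (by rwa [← hgL]) (by rwa [← hgL])
  have huniq := fun φp φm (hφ : IsWienerHopf φ φp φm) =>
    hφ.onCircle_eq hp' hm hpp hmm hm1 hf
  have huniqν := fun φp φm (hφ : IsWienerHopf φ φp φm) =>
    hφ.onCircle_eq hP' hM hPP hMM hM1 hg
  -- Comparing one Wiener–Hopf factorization with both algebraic ones shows that the Wiener algebra
  -- factors lie in `W_ν`.
  have hPp : ⇑(BAlg.toC P') = BAlg.toC p' :=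
    (huniqν _ _ hWH).2.2.1.symm.trans (huniq _ _ hWH).2.2.1
  have hMm : ⇑(BAlg.toC M') = BAlg.toC m' :=
    (huniqν _ _ hWH).2.2.2.symm.trans (huniq _ _ hWH).2.2.2
  -- Both weighted estimates are instances: `w n = exp (n A(ν))` always minorizes the weight on the
  -- tail, and `w n = ν n` does so when `ν` increases.
  have hweight : ∀ w : ℕ → ℝ, (∀ n, 0 < w n) → (∀ (n : ℕ) (k : ℤ), (n : ℤ) ≤ |k| → w n ≤ ν k) →
      ∃ C : ℝ, ∀ n ≥ N, ∀ j k : Fin (n + 1),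
        ‖truncInvEntry n φ j k - toeplitzInvEntry φ j k‖ ≤
          C * min (w (n + 1 - k))⁻¹ (w (n + 1 - j))⁻¹ := by
    intro w hw0 hw
    refine ⟨c * (‖P'‖ * ‖m'‖ + ‖p'‖ * ‖M'‖), fun n hn j k => ?_⟩
    refine le_mul_min_of_le_mul hc (norm_nonneg _) (norm_nonneg _) (inv_nonneg.2 (hw0 _).le)
      (inv_nonneg.2 (hw0 _).le) (norm_nonneg _) (norm_nonneg _) ((hN n hn).2 j k) ?_ ?_
      (BAlg.norm_tail_le _ _) (BAlg.norm_tail_le _ _)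
    · rw [← div_eq_mul_inv, le_div_iff₀ (hw0 _)]
      exact BAlg.norm_tail_mul_le hPp (hw _)
    · rw [← div_eq_mul_inv, le_div_iff₀ (hw0 _)]
      exact BAlg.norm_tail_mul_le hMm (hw _)
  refine ⟨hunit, ⟨_, _, hWH⟩, fun φp φm hφ => ?_, fun n hn => (hN n hn).1,
    fun φp φm hφ n hn j k => ?_, fun hA => ?_, fun hmono => ?_⟩
  · obtain ⟨h1, h2, h3, h4⟩ := huniqν φp φm hφ
    rw [h1, h2, h3, h4]
    exact ⟨BAlg.toC_mem_beurlingClass _, BAlg.toC_mem_beurlingClass _,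
      BAlg.toC_mem_beurlingClass _, BAlg.toC_mem_beurlingClass _⟩
  · obtain ⟨h1, h2, h3, h4⟩ := huniq φp φm hφ
    have htp : ∀ i, ‖BAlg.tail i p'‖ ≤ 1 * tripleSeminorm (fun _ => 1) i φp φm := fun i => by
      rw [one_mul, BAlg.norm_tail, ← h3]
      exact (le_max_left _ _).trans (le_max_right _ _)
    have htm : ∀ i, ‖BAlg.tail i m'‖ ≤ 1 * tripleSeminorm (fun _ => 1) i φp φm := fun i => by
      rw [one_mul, BAlg.norm_tail, ← h4]
      exact (le_max_right _ _).trans (le_max_right _ _)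
    have h0 : ∀ i, 0 ≤ tripleSeminorm (fun _ => 1) i φp φm := fun i => by
      simpa using (norm_nonneg _).trans (htp i)
    exact le_mul_min_of_le_mul hc (norm_nonneg _) (norm_nonneg _) (h0 _) (h0 _) zero_le_one
      zero_le_one ((hN n hn).2 j k) (htp _) (htm _) (BAlg.norm_tail_le _ _) (BAlg.norm_tail_le _ _)
  · simp only [Real.exp_neg]
    refine hweight (fun n => Real.exp (n * growthRate ν)) (fun n => Real.exp_pos _) fun n k hk => ?_
    refine (Real.exp_le_exp.2 ?_).trans (exp_natAbs_mul_growthRate_le hν k)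
    refine mul_le_mul_of_nonneg_right ?_ hA.le
    rw [Int.abs_eq_natAbs] at hk
    exact_mod_cast hk
  · refine hweight (fun n => ν n) (fun n => hν.pos _) fun n k hk => ?_
    rw [hν.abs k]
    rw [Int.abs_eq_natAbs] at hk
    rcases hk.eq_or_lt with h1 | h1
    · rw [h1]
    · exact hmono _ _ (Int.natCast_nonneg n) h1
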